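/- Corollary (Area formula by the horizontal lift). Identify $\mathbb{R}^3$ with the imaginary quaternions $\operatorname{Im}\mathbb{H}$, so that $\mathbb{S}^2\subset\operatorname{Im}\mathbb{H}$, and let $\pi\colon\mathbb{S}^3\to\mathbb{S}^2$, $\pi(q)=q\,\mathbf{i}\,\bar q$, be the Hopf fibration on the unit quaternions. For $p,p'\in\mathbb{S}^2$ with $p'\neq -p$ put $$\operatorname{Dihedral}(p,p')=\sqrt{\tfrac{1+\langle p,p'\rangle}{2}}+\frac{p\times p'}{\sqrt{2+2\langle p,p'\rangle}}\in\mathbb{S}^3 .$$ Let $\Gamma=(p_i)_{i\in\mathbb{Z}/n\mathbb{Z}}$, $n\ge 1$, be a spherical polygon, i.e. a cyclic list of points of $\mathbb{S}^2$ with $p_{i+1}\ne -p_i$ for all $i\in\mathbb{Z}/n\mathbb{Z}$. (Points may coincide, edges may cross or fold back.) Consecutive vertices are joined by the shortest great-circle arc, which is constant if they coincide. Let $C_\Gamma\colon\partial\mathbb{D}^2\to\mathbb{S}^2$ be the closed path obtained by concatenating these arcs, $$C_\Gamma\bigl(e^{2\pi \mathrm{i}(k+s)/n}\bigr)=\frac{(1-s)p_k+s\,p_{k+1}}{|(1-s)p_k+s\,p_{k+1}|}\qquad(0\le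 k<n,\ 0\le s\le 1).$$ The signed area of $\Gamma$ is $$\operatorname{Area}(\Gamma)=\iint_{\mathbb{D}^2}S^*\sigma\in\mathbb{R}/4\pi\mathbb{Z},$$ where $S\colon\mathbb{D}^2\to\mathbb{S}^2$ is any Lipschitz map on the closed unit disk that extends $C_\Gamma$ and $\sigma=x\,dy\wedge dz+y\,dz\wedge dx+z\,dx\wedge dy$ is the standard area form of $\mathbb{S}^2$. Such $S$ exist, and the class of the integral modulo $4\pi$ does not depend on $S$. Take $q_0\in\pi^{-1}(p_0)$ and define inductively $q_{i+1}=\operatorname{Dihedral}(p_i,p_{i+1})\,q_i$ for $i=0,\dots,n-1$, where $p_n=p_0$. Then $\bar q_0q_n=e^{\mathbf{i}\theta}$ for some $\theta\in\mathbb{R}$, and, writing $\arg(\bar q_0 q_n)=\theta$, which is unique modulo $2\pi$, $$\operatorname{Area}(\Gamma)=2\arg(\bar q_0 q_n)\mod 4\pi .$$ -/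

import Mathlib

open scoped Quaternion Matrix

noncomputable section

/-- Euclidean three-space, which contains the sphere `S²` as its unit sphere. -/
abbrev E3 : Type := EuclideanSpace ℝ (Fin 3)

/-- The unit sphere `S² ⊂ ℝ³`. -/
abbrev S2 : Set E3 := Metric.sphere (0 : E3) 1

/-- The identification `ℝ³ ≅ Im ℍ`, `(x, y, z) ↦ x i + y j + z k`. -/
def imQuat (v : E3) : ℍ[ℝ] := ⟨0, v 0, v 1, v 2⟩

/-- The cross product of `ℝ³`. -/
def cross (u v : E3) : E3 := WithLp.toLp 2 (u.ofLp ⨯₃ v.ofLp)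

/-- The quaternion unit `i`. -/
def quatI : ℍ[ℝ] := ⟨0, 1, 0, 0⟩

/-- The fibre over `p ∈ S²` of the Hopf fibration `S³ → S²`, `q ↦ q i q̄`. -/
def hopfFibre (p : E3) : Set ℍ[ℝ] :=
  {q | ‖q‖ = 1 ∧ q * quatI * star q = imQuat p}

/-- `Dihedral(p, p') = √((1 + ⟨p, p'⟩) / 2) + (p × p') / √(2 + 2 ⟨p, p'⟩)`,
for non-antipodal `p, p' ∈ S²`. -/
def dihedral (p p' : E3) : ℍ[ℝ] :=
  ((√((1 + inner ℝ p p') / 2) : ℝ) : ℍ[ℝ]) +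
    (√(2 + 2 * inner ℝ p p'))⁻¹ • imQuat (cross p p')

/-- The argument of a quaternion `w + x i` of the complex plane `ℂ ⊂ ℍ`. -/
def quatArg (u : ℍ[ℝ]) : ℝ := Complex.arg ⟨u.re, u.imI⟩

/-- The shortest path from `p` to `p'` on `S²`, for non-antipodal `p, p' ∈ S²`: the shorter
great-circle arc, parametrized over `s ∈ [0, 1]` as the radial projection of the chord
(a constant path if `p = p'`). -/
def greatArc (p p' : E3) (s : ℝ) : E3 :=
  ‖(1 - s) • p + s • p'‖⁻¹ • ((1 - s) • p + s • p')

/-- The standard area form of the unit sphere: `σ_x(u, v) = ⟨x, u × v⟩ = det (x, u, v)`, that is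
`x dy ∧ dz + y dz ∧ dx + z dx ∧ dy`. -/
def areaForm (x u v : E3) : ℝ := inner ℝ x (cross u v)

/-- The coefficient of `S^*σ` with respect to `dx ∧ dy` at the point `z = x + i y`. -/
def pullbackArea (S : ℂ → E3) (z : ℂ) : ℝ :=
  areaForm (S z) (fderiv ℝ S z 1) (fderiv ℝ S z Complex.I)

/-- `S` is an enclosed region of the spherical polygon `p`: a Lipschitz map from the closed unit
disk to `S²` whose restriction to the unit circle is the closed path `C_Γ`, which runs along the
edge from `p k` to `p (k + 1)` as the angle goes from `2πk/n` to `2π(k+1)/n`. By Rademacher's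
theorem such a map is differentiable almost everywhere. The values of `S` off the closed disk
play no role. -/
structure IsEnclosedRegion {n : ℕ} (p : ZMod n → S2) (S : ℂ → E3) : Prop where
  lipschitz : ∃ K : NNReal, LipschitzOnWith K S (Metric.closedBall 0 1)
  mapsTo : Set.MapsTo S (Metric.closedBall 0 1) S2
  boundary : ∀ k : ℕ, k < n → ∀ s ∈ Set.Icc (0 : ℝ) 1,
    S (Complex.exp (((2 * Real.pi * ((k + s) / n) : ℝ) : ℂ) * Complex.I)) =
      greatArc (p (k : ZMod n)) (p ((k : ZMod n) + 1)) s

/-- The signed area `∬ S^*σ ∈ ℝ/4πℤ` of the polygon `p` is well defined and equal to `a`: there is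
an enclosed region `S`, and for each of them the integral over the disk converges absolutely and
represents `a`. -/
def HasSignedArea {n : ℕ} (p : ZMod n → S2) (a : AddCircle (4 * Real.pi)) : Prop :=
  (∃ S : ℂ → E3, IsEnclosedRegion p S) ∧
    ∀ S : ℂ → E3, IsEnclosedRegion p S →
      MeasureTheory.IntegrableOn (pullbackArea S) (Metric.ball 0 1) ∧
        ((∫ z in Metric.ball (0 : ℂ) 1, pullbackArea S z : ℝ) : AddCircle (4 * Real.pi)) = a

end

/-! The circle bundle `S³ → S²` carries the connection form ω, the `i`-component of `q̄ dq`, and the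
area form pulls back to -2 dω (`areaForm_hopf`). The disk is contractible, so an enclosed region S
lifts to a Lipschitz map Q into the unit quaternions (`exists_lipschitz_hopf_lift`). Stokes' theorem
then turns the area into -2A, where A is the integral of ω along the boundary values γ of Q
(`integral_pullbackArea`).

Horizontal lifts, those with ω = 0, compute A. Over a great-circle arc starting at p, the curve x ↦
`dihedral p x * q` is horizontal, so the q_k are the vertex values of a horizontal lift of the
polygon. The phase of γ relative to this lift is multiplied by exp(i∫ω) along each edge
(`complexPart_holonomy`). As γ closes up and the horizontal lift does not, the product over all
edges is the conjugate of z = q̄₀qₙ (`conj_eq_exp_integral`). Hence arg z = -A modulo 2π, and the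
area -2A is 2 arg z modulo 4π. This holds for every S, so independence of S needs no separate
argument.

Lipschitz regularity only gives derivatives almost everywhere. Stokes is therefore proved in polar
coordinates by difference quotients in r and integration by parts in t
(`IsPolarStrip.integral_jacobian`), which needs no second derivatives. The phase comparison rests on
an absolutely continuous function with zero derivative almost everywhere being constant.

An enclosed region exists because one can cone off the boundary path from a vector outside the
finitely many planes spanned by edges and project radially (`exists_isEnclosedRegion`). -/

section

open MeasureTheory Set Filter Topology

/-! ### Green's formula for Lipschitz functions on a polar strip. -/

/-- A bounded Lipschitz function on the strip `ℝ × [α, β]` with equal values on the two sides,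
which is constant for `r ≤ 0` and does not depend on `r` for `1 ≤ r`: what a Lipschitz function on
the closed unit disk becomes in polar coordinates. -/
structure IsPolarStrip (α β : ℝ) (a : ℝ × ℝ → ℝ) : Prop where
  lipschitz : ∃ K, LipschitzWith K a
  bounded : ∃ M, ∀ x, |a x| ≤ M
  sides : ∀ r, a (r, α) = a (r, β)
  left : ∀ r t, r ≤ 0 → a (r, t) = a (0, 0)
  right : ∀ r t, 1 ≤ r → a (r, t) = a (1, t)

section BoundedIterated

variable {g : ℝ × ℝ → ℝ} {M : ℝ}

theorem integrableOn_rect_of_bounded (hg : Measurable g) (hM : ∀ x, |g x| ≤ M) (u v α β : ℝ) :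
    IntegrableOn g (Ioc u v ×ˢ Ioc α β) := by
  refine Measure.integrableOn_of_bounded (M := M) ?_ hg.aestronglyMeasurable
    (.of_forall fun x ↦ by simpa using hM x)
  rw [Measure.volume_eq_prod, Measure.prod_prod]
  simp [ENNReal.mul_eq_top]

theorem intervalIntegrable_inner_of_bounded (hg : Measurable g) (hM : ∀ x, |g x| ≤ M)
    {u v α β : ℝ} (hαβ : α ≤ β) :
    IntervalIntegrable (fun r ↦ ∫ t in α..β, g (r, t)) volume u v := by
  have key : ∀ u v, IntegrableOn (fun r ↦ ∫ t in α..β, g (r, t)) (Ioc u v) := by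
    intro u v
    have h := integrableOn_rect_of_bounded hg hM u v α β
    rw [IntegrableOn, Measure.volume_eq_prod, ← Measure.prod_restrict] at h
    simpa only [intervalIntegral.integral_of_le hαβ] using! h.integral_prod_left
  exact ⟨key u v, key v u⟩

theorem integral_integral_eq_setIntegral_rect (hg : Measurable g) (hM : ∀ x, |g x| ≤ M)
    {u v α β : ℝ} (huv : u ≤ v) (hαβ : α ≤ β) :
    ∫ r in u..v, ∫ t in α..β, g (r, t) = ∫ x in Ioc u v ×ˢ Ioc α β, g x := by
  have h := integrableOn_rect_of_bounded hg hM u v α β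
  rw [Measure.volume_eq_prod] at h ⊢
  rw [setIntegral_prod _ h]
  simp only [intervalIntegral.integral_of_le hαβ, intervalIntegral.integral_of_le huv]

theorem intervalIntegrable_slice_of_bounded (hg : Measurable g) (hM : ∀ x, |g x| ≤ M)
    (r α β : ℝ) : IntervalIntegrable (fun t ↦ g (r, t)) volume α β := by
  have h : ∀ α β, IntegrableOn (fun t ↦ g (r, t)) (Ioc α β) := fun α β ↦
    Measure.integrableOn_of_bounded (M := M) (by simp)
      (hg.comp measurable_prodMk_left).aestronglyMeasurable (.of_forall fun t ↦ by simpa using hM _)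
  exact ⟨h α β, h β α⟩

end BoundedIterated

theorem lineDeriv_snd_eq_deriv (a : ℝ × ℝ → ℝ) (r t : ℝ) :
    lineDeriv ℝ a (r, t) (0, 1) = deriv (fun s ↦ a (r, s)) t := by
  have := deriv_comp_const_add (fun s ↦ a (r, s)) t 0
  simpa [lineDeriv] using this

namespace IsPolarStrip

variable {α β : ℝ} {a b : ℝ × ℝ → ℝ}

theorem measurable_lineDeriv (ha : IsPolarStrip α β a) (v : ℝ × ℝ) :
    Measurable fun x ↦ lineDeriv ℝ a x v := by
  obtain ⟨K, hK⟩ := ha.lipschitz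
  exact _root_.measurable_lineDeriv hK.continuous

theorem measurable (ha : IsPolarStrip α β a) : Measurable a := by
  obtain ⟨K, hK⟩ := ha.lipschitz
  exact hK.continuous.measurable

theorem lineDeriv_fst_eq_zero_of_neg (ha : IsPolarStrip α β a) {r : ℝ} (hr : r < 0) (t : ℝ) :
    lineDeriv ℝ a (r, t) (1, 0) = 0 := by
  have : (fun s : ℝ ↦ a ((r, t) + s • (1, 0))) =ᶠ[𝓝 0] fun _ ↦ a (0, 0) := by
    filter_upwards [gt_mem_nhds (neg_pos.2 hr)] with s hs
    simpa using ha.left (r + s) t (by linarith)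
  rw [lineDeriv, this.deriv_eq, deriv_const]

theorem lineDeriv_fst_eq_zero_of_one_lt (ha : IsPolarStrip α β a) {r : ℝ} (hr : 1 < r) (t : ℝ) :
    lineDeriv ℝ a (r, t) (1, 0) = 0 := by
  have : (fun s : ℝ ↦ a ((r, t) + s • (1, 0))) =ᶠ[𝓝 0] fun _ ↦ a (1, t) := by
    filter_upwards [lt_mem_nhds (sub_neg.2 hr)] with s hs
    simpa using ha.right (r + s) t (by linarith)
  rw [lineDeriv, this.deriv_eq, deriv_const]

theorem lineDeriv_snd_eq_zero (ha : IsPolarStrip α β a) {r : ℝ} (hr : r ≤ 0) (t : ℝ) :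
    lineDeriv ℝ a (r, t) (0, 1) = 0 := by
  rw [lineDeriv_snd_eq_deriv, show (fun s ↦ a (r, s)) = fun _ ↦ a (0, 0) from
    funext fun s ↦ ha.left r s hr]
  simp

theorem lineDeriv_snd_of_one_le (ha : IsPolarStrip α β a) {r : ℝ} (hr : 1 ≤ r) (t : ℝ) :
    lineDeriv ℝ a (r, t) (0, 1) = lineDeriv ℝ a (1, t) (0, 1) := by
  simp only [lineDeriv_snd_eq_deriv, ha.right r _ hr]

theorem absolutelyContinuousOnInterval_slice (ha : IsPolarStrip α β a) (r u v : ℝ) :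
    AbsolutelyContinuousOnInterval (fun t ↦ a (r, t)) u v := by
  obtain ⟨K, hK⟩ := ha.lipschitz
  exact (hK.comp (LipschitzWith.prodMk_left r)).lipschitzOnWith.absolutelyContinuousOnInterval

/-- Integration by parts on a vertical segment. -/
theorem integral_mul_lineDeriv_snd (ha : IsPolarStrip α β a) (hb : IsPolarStrip α β b)
    (r r' s : ℝ) :
    ∫ t in α..β, a (r, t) * (lineDeriv ℝ b (r', t) (0, 1) - lineDeriv ℝ b (s, t) (0, 1)) =
      -∫ t in α..β, lineDeriv ℝ a (r, t) (0, 1) * (b (r', t) - b (s, t)) := by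
  have hA := ha.absolutelyContinuousOnInterval_slice r α β
  have key : ∀ r', ∫ t in α..β, a (r, t) * lineDeriv ℝ b (r', t) (0, 1) =
      -∫ t in α..β, lineDeriv ℝ a (r, t) (0, 1) * b (r', t) := by
    intro r'
    have := hA.integral_mul_deriv_eq_deriv_mul (hb.absolutelyContinuousOnInterval_slice r' α β)
    simp only [lineDeriv_snd_eq_deriv]
    rw [this, ha.sides, hb.sides]
    ring
  have hi : ∀ r', IntervalIntegrable (fun t ↦ a (r, t) * lineDeriv ℝ b (r', t) (0, 1))
      volume α β := fun r' ↦ by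
    simp only [lineDeriv_snd_eq_deriv]
    exact (hb.absolutelyContinuousOnInterval_slice r' α β).intervalIntegrable_deriv.continuousOn_mul
      hA.continuousOn
  have hj : ∀ r', IntervalIntegrable (fun t ↦ lineDeriv ℝ a (r, t) (0, 1) * b (r', t))
      volume α β := fun r' ↦ by
    simp only [lineDeriv_snd_eq_deriv]
    exact hA.intervalIntegrable_deriv.mul_continuousOn
      (hb.absolutelyContinuousOnInterval_slice r' α β).continuousOn
  simp only [mul_sub]
  rw [intervalIntegral.integral_sub (hi _) (hi _), intervalIntegral.integral_sub (hj _) (hj _),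
    key, key]
  ring

/-- The difference quotient version of Green's formula on the strip. -/
theorem integral_boundary_eq_differenceQuotient (ha : IsPolarStrip α β a)
    (hb : IsPolarStrip α β b) (hαβ : α ≤ β) {h : ℝ} (h0 : 0 < h) (h1 : h < 1) :
    ∫ t in α..β, a (1, t) * lineDeriv ℝ b (1, t) (0, 1) =
      ∫ x in Ioc (-1 : ℝ) 2 ×ˢ Ioc α β,
        (h⁻¹ * (a x - a (x.1 - h, x.2)) * lineDeriv ℝ b x (0, 1) -
          lineDeriv ℝ a x (0, 1) * (h⁻¹ * (b (x.1 + h, x.2) - b x))) := by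
  obtain ⟨Ka, hKa⟩ := ha.lipschitz
  obtain ⟨Kb, hKb⟩ := hb.lipschitz
  obtain ⟨A, hA⟩ := ha.bounded
  obtain ⟨B, hB⟩ := hb.bounded
  have da : ∀ x, |lineDeriv ℝ a x (0, 1)| ≤ Ka := fun x ↦ by
    simpa using norm_lineDeriv_le_of_lipschitz ℝ hKa (x₀ := x) (v := (0, 1))
  have db : ∀ x, |lineDeriv ℝ b x (0, 1)| ≤ Kb := fun x ↦ by
    simpa using norm_lineDeriv_le_of_lipschitz ℝ hKb (x₀ := x) (v := (0, 1))
  have mda := ha.measurable_lineDeriv (0, 1)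
  have mdb := hb.measurable_lineDeriv (0, 1)
  have ma := ha.measurable
  have mb := hb.measurable
  set f : ℝ × ℝ → ℝ := fun x ↦ a x * lineDeriv ℝ b x (0, 1) with hf
  set p : ℝ × ℝ → ℝ := fun x ↦ (a x - a (x.1 - h, x.2)) * lineDeriv ℝ b x (0, 1) with hp
  set q : ℝ × ℝ → ℝ := fun x ↦ lineDeriv ℝ a x (0, 1) * (b (x.1 + h, x.2) - b x) with hq
  have mf : Measurable f := ma.mul mdb
  have mp : Measurable p := (ma.sub (ma.comp (by fun_prop))).mul mdb
  have mq : Measurable q := mda.mul ((mb.comp (by fun_prop)).sub mb)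
  have bf : ∀ x, |f x| ≤ A * Kb := fun x ↦ by
    rw [hf, abs_mul]
    exact mul_le_mul (hA x) (db x) (abs_nonneg _) ((abs_nonneg _).trans (hA x))
  have bp : ∀ x, |p x| ≤ (A + A) * Kb := fun x ↦ by
    rw [hp, abs_mul]
    refine mul_le_mul ((abs_sub _ _).trans (add_le_add (hA _) (hA _))) (db x) (abs_nonneg _) ?_
    linarith [(abs_nonneg _).trans (hA x)]
  have bq : ∀ x, |q x| ≤ Ka * (B + B) := fun x ↦ by
    rw [hq, abs_mul]
    exact mul_le_mul (da x) ((abs_sub _ _).trans (add_le_add (hB _) (hB _))) (abs_nonneg _)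
      (by positivity)
  set F : ℝ → ℝ := fun r ↦ ∫ t in α..β, f (r, t) with hF
  set P : ℝ → ℝ := fun r ↦ ∫ t in α..β, p (r, t) with hP
  set Q : ℝ → ℝ := fun r ↦ ∫ t in α..β, q (r, t) with hQ
  have iF : ∀ u v, IntervalIntegrable F volume u v := fun u v ↦
    intervalIntegrable_inner_of_bounded mf bf hαβ
  have iP : ∀ u v, IntervalIntegrable P volume u v := fun u v ↦
    intervalIntegrable_inner_of_bounded mp bp hαβ
  have iQ : ∀ u v, IntervalIntegrable Q volume u v := fun u v ↦
    intervalIntegrable_inner_of_bounded mq bq hαβ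
  -- Discrete product rule in r, followed by integration by parts in t to move the t-derivative off
  -- the increment of `b`.
  have step : ∀ r, F (r + h) - F r = P (r + h) - Q r := by
    intro r
    have e := ha.integral_mul_lineDeriv_snd hb r (r + h) r
    have sf := fun r ↦ intervalIntegrable_slice_of_bounded mf bf r α β
    have sp := intervalIntegrable_slice_of_bounded mp bp (r + h) α β
    simp only [hF, hP, hQ]
    rw [sub_eq_add_neg (∫ t in α..β, p (r + h, t)), hq, ← e,
      ← intervalIntegral.integral_sub (sf _) (sf _), ← sub_eq_iff_eq_add',
      ← intervalIntegral.integral_sub ((sf _).sub (sf _)) sp]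
    refine intervalIntegral.integral_congr fun t _ ↦ ?_
    simp only [hf, hp, add_sub_cancel_right]
    ring
  have F0 : ∀ r, r ≤ 0 → F r = 0 := fun r hr ↦ by
    simp [hF, hf, hb.lineDeriv_snd_eq_zero hr]
  have F1 : ∀ r, 1 ≤ r → F r = F 1 := fun r hr ↦ by
    simp only [hF, hf, hb.lineDeriv_snd_of_one_le hr, ha.right r _ hr]
  have P0 : ∀ r, r ≤ 0 → P r = 0 := fun r hr ↦ by
    simp [hP, hp, hb.lineDeriv_snd_eq_zero hr]
  have P1 : ∀ r, 1 + h ≤ r → P r = 0 := fun r hr ↦ by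
    simp [hP, hp, ha.right r _ (by linarith), ha.right (r - h) _ (by linarith)]
  -- Integrating `step` over [-1, 2] telescopes. Since h < 1, the window contains the part of `P`
  -- that can be nonzero, so shifting `P` costs nothing, while shifting `F` gains h copies of its
  -- constant value for r ≥ 1.
  have shift : ∀ G : ℝ → ℝ, (∀ u v, IntervalIntegrable G volume u v) →
      ∫ r in (-1)..2, G (r + h) =
        (∫ r in (-1)..2, G r) + (∫ r in 2..(2 + h), G r) - ∫ r in (-1)..(-1 + h), G r := by
    intro G hG
    rw [intervalIntegral.integral_comp_add_right,
      intervalIntegral.integral_add_adjacent_intervals (hG _ _) (hG _ _),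
      ← intervalIntegral.integral_add_adjacent_intervals (hG (-1) (-1 + h)) (hG (-1 + h) (2 + h))]
    ring
  have tail : ∀ (G : ℝ → ℝ) (u v c : ℝ), u ≤ v → (∀ r ∈ Icc u v, G r = c) →
      ∫ r in u..v, G r = (v - u) * c := by
    intro G u v c huv hG
    rw [intervalIntegral.integral_congr (g := fun _ ↦ c) (by rwa [uIcc_of_le huv]),
      intervalIntegral.integral_const, smul_eq_mul]
  have sF : ∫ r in (-1)..2, F (r + h) = (∫ r in (-1)..2, F r) + h * F 1 := by
    rw [shift F iF, tail F 2 (2 + h) (F 1) (by linarith) fun r hr ↦ F1 r (by linarith [hr.1]),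
      tail F (-1) (-1 + h) 0 (by linarith) fun r hr ↦ F0 r (by linarith [hr.2])]
    ring
  have sP : ∫ r in (-1)..2, P (r + h) = ∫ r in (-1)..2, P r := by
    rw [shift P iP, tail P 2 (2 + h) 0 (by linarith) fun r hr ↦ P1 r (by linarith [hr.1]),
      tail P (-1) (-1 + h) 0 (by linarith) fun r hr ↦ P0 r (by linarith [hr.2])]
    ring
  have total : h * F 1 = (∫ r in (-1)..2, P r) - ∫ r in (-1)..2, Q r := by
    have iF' : IntervalIntegrable (fun r ↦ F (r + h)) volume (-1) 2 := by
      simpa using (iF (-1 + h) (2 + h)).comp_add_right h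
    have iP' : IntervalIntegrable (fun r ↦ P (r + h)) volume (-1) 2 := by
      simpa using (iP (-1 + h) (2 + h)).comp_add_right h
    have := intervalIntegral.integral_congr (μ := volume) (a := (-1 : ℝ)) (b := 2)
      fun r _ ↦ step r
    rw [intervalIntegral.integral_sub iF' (iF _ _), intervalIntegral.integral_sub iP' (iQ _ _),
      sF, sP] at this
    linarith
  rw [hP, hQ, integral_integral_eq_setIntegral_rect mp bp (by norm_num) hαβ,
    integral_integral_eq_setIntegral_rect mq bq (by norm_num) hαβ,
    ← integral_sub (integrableOn_rect_of_bounded mp bp _ _ _ _)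
      (integrableOn_rect_of_bounded mq bq _ _ _ _)] at total
  change F 1 = _
  rw [← mul_right_inj' h0.ne', total, ← integral_const_mul]
  refine integral_congr_ae (.of_forall fun x ↦ ?_)
  simp only [hp, hq]
  field_simp

/-- **Green's formula** in polar coordinates, for Lipschitz functions. -/
theorem integral_jacobian (ha : IsPolarStrip α β a) (hb : IsPolarStrip α β b) (hαβ : α ≤ β) :
    ∫ x in Ioo (0 : ℝ) 1 ×ˢ Ioo α β, (lineDeriv ℝ a x (1, 0) * lineDeriv ℝ b x (0, 1) -
        lineDeriv ℝ a x (0, 1) * lineDeriv ℝ b x (1, 0)) =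
      ∫ t in α..β, a (1, t) * lineDeriv ℝ b (1, t) (0, 1) := by
  obtain ⟨Ka, hKa⟩ := ha.lipschitz
  obtain ⟨Kb, hKb⟩ := hb.lipschitz
  have da : ∀ x, |lineDeriv ℝ a x (0, 1)| ≤ Ka := fun x ↦ by
    simpa using norm_lineDeriv_le_of_lipschitz ℝ hKa (x₀ := x) (v := (0, 1))
  have db : ∀ x, |lineDeriv ℝ b x (0, 1)| ≤ Kb := fun x ↦ by
    simpa using norm_lineDeriv_le_of_lipschitz ℝ hKb (x₀ := x) (v := (0, 1))
  have quot : ∀ {g : ℝ × ℝ → ℝ} {K : NNReal}, LipschitzWith K g → ∀ {h : ℝ}, 0 < h →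
      ∀ r s t, |r - s| = h → |h⁻¹ * (g (r, t) - g (s, t))| ≤ K := by
    intro g K hg h h0 r s t hrs
    rw [abs_mul, abs_of_pos (inv_pos.2 h0), inv_mul_le_iff₀ h0]
    have := hg.dist_le_mul (r, t) (s, t)
    simpa [Prod.dist_eq, Real.dist_eq, hrs, mul_comm, h0.le] using this
  set J : ℝ × ℝ → ℝ := fun x ↦ lineDeriv ℝ a x (1, 0) * lineDeriv ℝ b x (0, 1) -
        lineDeriv ℝ a x (0, 1) * lineDeriv ℝ b x (1, 0) with hJ
  -- The summand 2 keeps the step below 1 for every n, as the difference quotient formula requires.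
  have lim : Tendsto (fun n : ℕ ↦ ((n : ℝ) + 2)⁻¹) atTop (𝓝[>] 0) :=
    tendsto_nhdsWithin_iff.2 ⟨tendsto_inv_atTop_zero.comp
      (tendsto_atTop_add_const_right _ _ tendsto_natCast_atTop_atTop),
      .of_forall fun n ↦ by simp only [mem_Ioi]; positivity⟩
  have hlim : Tendsto (fun n : ℕ ↦ ∫ x in Ioc (-1 : ℝ) 2 ×ˢ Ioc α β,
        (((n : ℝ) + 2)⁻¹⁻¹ * (a x - a (x.1 - ((n : ℝ) + 2)⁻¹, x.2)) * lineDeriv ℝ b x (0, 1) -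
          lineDeriv ℝ a x (0, 1) * (((n : ℝ) + 2)⁻¹⁻¹ * (b (x.1 + ((n : ℝ) + 2)⁻¹, x.2) - b x))))
        atTop (𝓝 (∫ x in Ioc (-1 : ℝ) 2 ×ˢ Ioc α β, J x)) := by
    refine tendsto_integral_of_dominated_convergence (fun _ ↦ Ka * Kb + Ka * Kb) ?_ ?_ ?_ ?_
    · intro n
      exact (((measurable_const.mul (ha.measurable.sub (ha.measurable.comp (by fun_prop)))).mul
        (hb.measurable_lineDeriv _)).sub ((ha.measurable_lineDeriv _).mul
        (measurable_const.mul
          ((hb.measurable.comp (by fun_prop)).sub hb.measurable)))).aestronglyMeasurable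
    · exact integrableOn_rect_of_bounded (M := |(Ka * Kb + Ka * Kb : ℝ)|) measurable_const
        (fun _ ↦ le_rfl) _ _ _ _
    · intro n
      refine .of_forall fun x ↦ ?_
      have h0 : (0 : ℝ) < ((n : ℝ) + 2)⁻¹ := by positivity
      rw [Real.norm_eq_abs]
      refine (abs_sub _ _).trans (add_le_add ?_ ?_)
      · rw [abs_mul]
        exact mul_le_mul (quot hKa h0 x.1 _ x.2 (by simp [abs_of_pos h0])) (db x) (abs_nonneg _)
          (by positivity)
      · rw [abs_mul]
        exact mul_le_mul (da x) (quot hKb h0 _ x.1 x.2 (by simp [abs_of_pos h0])) (abs_nonneg _)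
          (by positivity)
    · refine ae_restrict_of_ae ?_
      filter_upwards [hKa.ae_lineDifferentiableAt (μ := volume) (1, 0),
        hKb.ae_lineDifferentiableAt (μ := volume) (1, 0)] with x hax hbx
      refine Tendsto.sub (Tendsto.mul_const _ ?_) (Tendsto.const_mul _ ?_)
      · have := hax.hasLineDerivAt.tendsto_slope_zero
        -- The quotient of `a` is a backward one, hence the slope at a negative increment.
        have h2 : Tendsto (fun n : ℕ ↦ -((n : ℝ) + 2)⁻¹) atTop (𝓝[≠] 0) := by
          have : Tendsto (fun n : ℕ ↦ -((n : ℝ) + 2)⁻¹) atTop (𝓝[<] 0) := by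
            have := (tendsto_neg_nhdsGT (a := (0 : ℝ))).comp lim
            rwa [neg_zero] at this
          exact this.mono_right (nhdsWithin_mono _ fun y hy ↦ ne_of_lt hy)
        refine (this.comp h2).congr fun n ↦ ?_
        simp only [Function.comp, smul_eq_mul]
        rw [show x + -((n : ℝ) + 2)⁻¹ • ((1, 0) : ℝ × ℝ) = (x.1 - ((n : ℝ) + 2)⁻¹, x.2) by
          ext <;> simp [sub_eq_add_neg]]
        rw [inv_neg]; ring
      · have := hbx.hasLineDerivAt.tendsto_slope_zero
        have h2 : Tendsto (fun n : ℕ ↦ ((n : ℝ) + 2)⁻¹) atTop (𝓝[≠] 0) :=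
          lim.mono_right (nhdsWithin_mono _ fun y hy ↦ ne_of_gt hy)
        refine (this.comp h2).congr fun n ↦ ?_
        simp only [Function.comp, smul_eq_mul]
        rw [show x + ((n : ℝ) + 2)⁻¹ • ((1, 0) : ℝ × ℝ) = (x.1 + ((n : ℝ) + 2)⁻¹, x.2) by
          ext <;> simp]
  have hconst : ∀ n : ℕ, ∫ x in Ioc (-1 : ℝ) 2 ×ˢ Ioc α β,
        (((n : ℝ) + 2)⁻¹⁻¹ * (a x - a (x.1 - ((n : ℝ) + 2)⁻¹, x.2)) * lineDeriv ℝ b x (0, 1) -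
          lineDeriv ℝ a x (0, 1) * (((n : ℝ) + 2)⁻¹⁻¹ * (b (x.1 + ((n : ℝ) + 2)⁻¹, x.2) - b x)))
      = ∫ t in α..β, a (1, t) * lineDeriv ℝ b (1, t) (0, 1) := fun n ↦
    (ha.integral_boundary_eq_differenceQuotient hb hαβ (by positivity)
      (inv_lt_one_of_one_lt₀ (by linarith [n.cast_nonneg (α := ℝ)]))).symm
  simp only [hconst] at hlim
  rw [tendsto_nhds_unique tendsto_const_nhds hlim]
  -- Outside 0 ≤ r ≤ 1 both radial derivatives vanish, so the window [-1, 2] can be cut back to the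
  -- disk.
  have hset : (Ioo (0 : ℝ) 1 ×ˢ Ioo α β : Set (ℝ × ℝ)) =ᵐ[volume] Icc (0 : ℝ) 1 ×ˢ Ioc α β := by
    rw [Measure.volume_eq_prod]
    exact Measure.set_prod_ae_eq Ioo_ae_eq_Icc Ioo_ae_eq_Ioc
  rw [setIntegral_congr_set hset]
  refine (setIntegral_eq_of_subset_of_forall_sdiff_eq_zero
    (measurableSet_Ioc.prod measurableSet_Ioc) ?_ ?_).symm
  · exact prod_mono (fun r hr ↦ ⟨by linarith [hr.1], by linarith [hr.2]⟩) subset_rfl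
  · rintro ⟨r, t⟩ ⟨⟨hr, ht⟩, hx⟩
    have : r < 0 ∨ 1 < r := by
      by_contra! hc
      exact hx ⟨hc, ht⟩
    rcases this with h | h
    · simp [ha.lineDeriv_fst_eq_zero_of_neg h, hb.lineDeriv_fst_eq_zero_of_neg h]
    · simp [ha.lineDeriv_fst_eq_zero_of_one_lt h, hb.lineDeriv_fst_eq_zero_of_one_lt h]

end IsPolarStrip

/-! ### Quaternion algebra: the area form on the Hopf bundle and the dihedral rotation. -/

theorem inner_E3 (u v : E3) : inner ℝ u v = u 0 * v 0 + u 1 * v 1 + u 2 * v 2 := by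
  simp [PiLp.inner_apply, Fin.sum_univ_three, mul_comm]

@[simp] theorem quatI_re : quatI.re = 0 := rfl
@[simp] theorem quatI_imI : quatI.imI = 1 := rfl
@[simp] theorem quatI_imJ : quatI.imJ = 0 := rfl
@[simp] theorem quatI_imK : quatI.imK = 0 := rfl

@[simp] theorem imQuat_re (v : E3) : (imQuat v).re = 0 := rfl
@[simp] theorem imQuat_imI (v : E3) : (imQuat v).imI = v 0 := rfl
@[simp] theorem imQuat_imJ (v : E3) : (imQuat v).imJ = v 1 := rfl
@[simp] theorem imQuat_imK (v : E3) : (imQuat v).imK = v 2 := rfl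

@[simp] theorem cross_zero (u v : E3) : cross u v 0 = u 1 * v 2 - u 2 * v 1 := by
  simp [cross, cross_apply]
@[simp] theorem cross_one (u v : E3) : cross u v 1 = u 2 * v 0 - u 0 * v 2 := by
  simp [cross, cross_apply]
@[simp] theorem cross_two (u v : E3) : cross u v 2 = u 0 * v 1 - u 1 * v 0 := by
  simp [cross, cross_apply]

/-- The vector part of a quaternion. -/
noncomputable def imVec : ℍ[ℝ] →L[ℝ] E3 :=
  LinearMap.toContinuousLinearMap
    { toFun := fun w ↦ !₂[w.imI, w.imJ, w.imK]
      map_add' := fun _ _ ↦ by ext i; fin_cases i <;> simp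
      map_smul' := fun _ _ ↦ by ext i; fin_cases i <;> simp }

theorem imVec_apply (w : ℍ[ℝ]) : imVec w = !₂[w.imI, w.imJ, w.imK] := rfl

@[simp] theorem imVec_imQuat (v : E3) : imVec (imQuat v) = v := by
  ext i; fin_cases i <;> simp [imVec_apply]

theorem star_mul_self_of_norm_eq_one {q : ℍ[ℝ]} (hq : ‖q‖ = 1) : star q * q = 1 := by
  rw [Quaternion.star_mul_self, Quaternion.normSq_eq_norm_mul_self, hq]; simp

theorem mul_star_self_of_norm_eq_one {q : ℍ[ℝ]} (hq : ‖q‖ = 1) : q * star q = 1 := by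
  rw [Quaternion.self_mul_star, Quaternion.normSq_eq_norm_mul_self, hq]; simp

theorem areaForm_imVec {a b c : ℍ[ℝ]} (ha : a.re = 0) (hb : b.re = 0) (hc : c.re = 0) :
    areaForm (imVec a) (imVec b) (imVec c) = -(a * b * c).re := by
  simp [areaForm, inner_E3, imVec_apply, ha, hb, hc]
  ring

/-- The pullback of the area form under the Hopf fibration, in terms of tangent vectors `X`, `Y`
to the unit quaternions at `Q`. -/
theorem areaForm_hopf {Q X Y : ℍ[ℝ]} (hQ : ‖Q‖ = 1) (hX : (star Q * X).re = 0)
    (hY : (star Q * Y).re = 0) :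
    areaForm (imVec (Q * quatI * star Q)) (imVec (X * quatI * star Q + Q * quatI * star X))
      (imVec (Y * quatI * star Q + Q * quatI * star Y)) = -4 * (star X * Y).imI := by
  have h1 := star_mul_self_of_norm_eq_one hQ
  have h2 := mul_star_self_of_norm_eq_one hQ
  have tangent : ∀ Z : ℍ[ℝ], (star Q * Z).re = 0 → Z = Q * (star Q * Z) ∧
      star Z = -(star Q * Z) * star Q := by
    intro Z hZ
    have : Z = Q * (star Q * Z) := by rw [← mul_assoc, h2, one_mul]
    refine ⟨this, ?_⟩
    have h3 : star (star Q * Z) = -(star Q * Z) := by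
      rw [Quaternion.star_eq_neg]; exact hZ
    rw [← h3, ← star_mul, ← this]
  obtain ⟨eX, sX⟩ := tangent X hX
  obtain ⟨eY, sY⟩ := tangent Y hY
  set ξ := star Q * X
  set η := star Q * Y
  -- Left translation by Q reduces the claim to Q = 1: X = Qξ with ξ imaginary is pushed forward to
  -- the conjugate of the commutator of ξ with i, and conjugation preserves the real part of a
  -- triple product.
  have comm : ∀ Z ζ : ℍ[ℝ], Z = Q * ζ → star Z = -ζ * star Q →
      Z * quatI * star Q + Q * quatI * star Z = Q * (ζ * quatI - quatI * ζ) * star Q := by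
    intro Z ζ e s
    rw [s, e]; noncomm_ring
  have re0 : ∀ ζ : ℍ[ℝ], ζ.re = 0 → (Q * ζ * star Q).re = 0 := by
    intro ζ h
    simp [h]; ring
  have c0 : ∀ ζ : ℍ[ℝ], (ζ * quatI - quatI * ζ).re = 0 := by
    intro ζ
    simp
  have conj3 : ∀ a b c : ℍ[ℝ], (Q * a * star Q * (Q * b * star Q) * (Q * c * star Q)).re =
      (a * b * c).re := by
    intro a b c
    have e : Q * a * star Q * (Q * b * star Q) * (Q * c * star Q) = Q * (a * b * c) * star Q := by
      calc _ = Q * a * (star Q * Q) * b * (star Q * Q) * c * star Q := by noncomm_ring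
        _ = _ := by rw [h1]; noncomm_ring
    have tr : ∀ x y : ℍ[ℝ], (x * y).re = (y * x).re := by intro x y; simp; ring
    rw [e, tr, ← mul_assoc, h1, one_mul]
  rw [comm X ξ eX sX, comm Y η eY sY, areaForm_imVec (re0 _ (by simp)) (re0 _ (c0 _))
    (re0 _ (c0 _)), conj3, sX, eY, show -ξ * star Q * (Q * η) = -ξ * (star Q * Q) * η by
    noncomm_ring, h1]
  simp [hX, hY]
  ring

theorem one_add_inner_pos {p p' : E3} (hp : p ∈ S2) (hp' : p' ∈ S2) (h : p' ≠ -p) :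
    0 < 1 + inner ℝ p p' := by
  rw [mem_sphere_zero_iff_norm] at hp hp'
  have h1 := norm_add_sq_real p p'
  have h2 : 0 < ‖p + p'‖ := norm_pos_iff.2 fun h0 ↦ h (eq_neg_of_add_eq_zero_right h0)
  rw [hp, hp'] at h1
  nlinarith [sq_pos_of_pos h2]

theorem sum_sq_eq_one {p : E3} (hp : p ∈ S2) : p 0 ^ 2 + p 1 ^ 2 + p 2 ^ 2 = 1 := by
  rw [mem_sphere_zero_iff_norm, EuclideanSpace.norm_eq, Real.sqrt_eq_one] at hp
  simpa [Fin.sum_univ_three] using hp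

/-- Only one square root s remains, with s² = 2 + 2⟨p, p'⟩, which makes the identities below
polynomial in s and s⁻¹. -/
theorem dihedral_eq (p p' : E3) : dihedral p p' =
    ((√(2 + 2 * inner ℝ p p') / 2 : ℝ) : ℍ[ℝ]) +
      (√(2 + 2 * inner ℝ p p'))⁻¹ • imQuat (cross p p') := by
  rw [dihedral, show (1 + inner ℝ p p') / 2 = (2 + 2 * inner ℝ p p') / 2 ^ 2 by ring,
    Real.sqrt_div' _ (by norm_num), Real.sqrt_sq (by norm_num)]

theorem norm_dihedral {p p' : E3} (hp : p ∈ S2) (hp' : p' ∈ S2) (h : 0 < 1 + inner ℝ p p') :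
    ‖dihedral p p'‖ = 1 := by
  have e1 := sum_sq_eq_one hp
  have e2 := sum_sq_eq_one hp'
  have hs : √(2 + 2 * inner ℝ p p') ^ 2 = 2 + 2 * inner ℝ p p' := Real.sq_sqrt (by linarith)
  have hs0 : 0 < √(2 + 2 * inner ℝ p p') := Real.sqrt_pos.2 (by linarith)
  rw [← sq_eq_sq₀ (norm_nonneg _) zero_le_one, sq, ← Quaternion.normSq_eq_norm_mul_self,
    Quaternion.normSq_def', dihedral_eq]
  rw [inner_E3] at hs hs0 ⊢
  set s := √(2 + 2 * (p 0 * p' 0 + p 1 * p' 1 + p 2 * p' 2))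
  simp only [Quaternion.re_add, Quaternion.imI_add, Quaternion.imJ_add,
    Quaternion.imK_add, Quaternion.re_coe, Quaternion.imI_coe, Quaternion.imJ_coe,
    Quaternion.imK_coe, Quaternion.re_smul, Quaternion.imI_smul, Quaternion.imJ_smul,
    Quaternion.imK_smul, smul_eq_mul, imQuat_re, imQuat_imI, imQuat_imJ, imQuat_imK, cross_zero,
    cross_one, cross_two]
  -- Lagrange's identity |p × p'|² = 1 - ⟨p, p'⟩², written in s.
  have key : (p 1 * p' 2 - p 2 * p' 1) ^ 2 + (p 2 * p' 0 - p 0 * p' 2) ^ 2 +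
      (p 0 * p' 1 - p 1 * p' 0) ^ 2 = s ^ 2 * (4 - s ^ 2) / 4 := by
    rw [hs]
    linear_combination (p' 0 ^ 2 + p' 1 ^ 2 + p' 2 ^ 2) * e1 + e2
  have hi : s⁻¹ ^ 2 * s ^ 2 = 1 := by rw [← mul_pow, inv_mul_cancel₀ hs0.ne', one_pow]
  linear_combination s⁻¹ ^ 2 * key + (4 - s ^ 2) / 4 * hi

/-- With s = √(2 + 2⟨p, p'⟩) the dihedral quaternion is s⁻¹(1 - p'p). As p² = p'² = -1, both (1 -
p'p)p and p'(1 - p'p) equal p + p'. -/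
theorem dihedral_mul_imQuat {p p' : E3} (hp : p ∈ S2) (hp' : p' ∈ S2)
    (h : 0 < 1 + inner ℝ p p') :
    dihedral p p' * imQuat p = imQuat p' * dihedral p p' := by
  have e1 := sum_sq_eq_one hp
  have e2 := sum_sq_eq_one hp'
  have hs : √(2 + 2 * inner ℝ p p') ^ 2 = 2 + 2 * inner ℝ p p' := Real.sq_sqrt (by linarith)
  have hs0 : 0 < √(2 + 2 * inner ℝ p p') := Real.sqrt_pos.2 (by linarith)
  have hi : √(2 + 2 * inner ℝ p p') =
      (√(2 + 2 * inner ℝ p p'))⁻¹ * (2 + 2 * inner ℝ p p') := by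
    rw [eq_inv_mul_iff_mul_eq₀ hs0.ne', ← sq, hs]
  rw [dihedral_eq]
  nth_rewrite 1 [hi]
  nth_rewrite 3 [hi]
  generalize (√(2 + 2 * inner ℝ p p'))⁻¹ = t
  rw [inner_E3]
  generalize hc : t * (2 + 2 * (p 0 * p' 0 + p 1 * p' 1 + p 2 * p' 2)) / 2 = c
  replace hc : c = t * (1 + (p 0 * p' 0 + p 1 * p' 1 + p 2 * p' 2)) := by rw [← hc]; ring
  ext <;> simp <;> try rw [hc]
  · ring
  · linear_combination t * p' 0 * e1 - t * p 0 * e2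
  · linear_combination t * p' 1 * e1 - t * p 1 * e2
  · linear_combination t * p' 2 * e1 - t * p 2 * e2

theorem dihedral_mul_mem_hopfFibre {p p' : E3} (hp : p ∈ S2) (hp' : p' ∈ S2)
    (h : 0 < 1 + inner ℝ p p') {q : ℍ[ℝ]} (hq : q ∈ hopfFibre p) :
    dihedral p p' * q ∈ hopfFibre p' := by
  have hD := norm_dihedral hp hp' h
  refine ⟨by rw [norm_mul, hD, hq.1, one_mul], ?_⟩
  calc dihedral p p' * q * quatI * star (dihedral p p' * q)
      = dihedral p p' * (q * quatI * star q) * star (dihedral p p') := by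
        rw [star_mul]; noncomm_ring
    _ = imQuat p' * (dihedral p p' * star (dihedral p p')) := by
        rw [hq.2, dihedral_mul_imQuat hp hp' h, mul_assoc]
    _ = imQuat p' := by rw [mul_star_self_of_norm_eq_one hD, mul_one]

/-- The quaternion 1 lies over i and a dihedral rotation carries it over any p ≠ -i. The antipode -i
is reached in two rotations, through j. -/
theorem hopfFibre_nonempty {p : E3} (hp : p ∈ S2) : (hopfFibre p).Nonempty := by
  have hi : (!₂[1, 0, 0] : E3) ∈ S2 := by
    simp [EuclideanSpace.norm_eq, Fin.sum_univ_three]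
  have hj : (!₂[0, 1, 0] : E3) ∈ S2 := by
    simp [EuclideanSpace.norm_eq, Fin.sum_univ_three]
  have base : (1 : ℍ[ℝ]) ∈ hopfFibre !₂[1, 0, 0] := ⟨norm_one, by
    ext <;> simp⟩
  by_cases h : p = -!₂[1, 0, 0]
  · have h1 : 0 < 1 + inner ℝ (!₂[1, 0, 0] : E3) (!₂[0, 1, 0] : E3) := by simp [inner_E3]
    have h2 : 0 < 1 + inner ℝ (!₂[0, 1, 0] : E3) p := by simp [h, inner_E3]
    exact ⟨_, dihedral_mul_mem_hopfFibre hj hp h2 (dihedral_mul_mem_hopfFibre hi hj h1 base)⟩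
  · exact ⟨_, dihedral_mul_mem_hopfFibre hi hp (one_add_inner_pos hi hp h) base⟩

/-! ### Lipschitz lifts through the Hopf fibration. -/

/-- A Lipschitz function on a compact set stays Lipschitz after composition with a function that is
continuously differentiable at all its values. -/
theorem LipschitzOnWith.exists_comp_of_contDiffAt {X F G : Type*} [PseudoMetricSpace X]
    [NormedAddCommGroup F] [NormedSpace ℝ F] [NormedAddCommGroup G] [NormedSpace ℝ G]
    {s : Set X} (hs : IsCompact s) {f : X → F} {K : NNReal} (hf : LipschitzOnWith K f s)
    {Φ : F → G} (hΦ : ∀ x ∈ s, ContDiffAt ℝ 1 Φ (f x)) :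
    ∃ K', LipschitzOnWith K' (fun x ↦ Φ (f x)) s := by
  refine LocallyLipschitzOn.exists_lipschitzOnWith_of_compact hs fun x hx ↦ ?_
  obtain ⟨K', t, ht, hK'⟩ := (hΦ x hx).exists_lipschitzOnWith
  refine ⟨K' * K, f ⁻¹' t ∩ s, inter_mem ((hf.continuousOn x hx) ht) self_mem_nhdsWithin, ?_⟩
  exact hK'.comp (hf.mono inter_subset_right) fun y hy ↦ hy.1

theorem LipschitzOnWith.exists_prodMk {X F G : Type*} [PseudoMetricSpace X]
    [PseudoMetricSpace F] [PseudoMetricSpace G] {s : Set X} {f : X → F} {g : X → G}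
    (hf : ∃ K, LipschitzOnWith K f s) (hg : ∃ K, LipschitzOnWith K g s) :
    ∃ K, LipschitzOnWith K (fun x ↦ (f x, g x)) s := by
  obtain ⟨K, hK⟩ := hf
  obtain ⟨L, hL⟩ := hg
  exact ⟨_, hK.prodMk hL⟩

/-- `imQuat` as a continuous linear map. -/
noncomputable def imQuatL : E3 →L[ℝ] ℍ[ℝ] :=
  LinearMap.toContinuousLinearMap
    { toFun := imQuat
      map_add' := fun _ _ ↦ by ext <;> simp
      map_smul' := fun _ _ ↦ by ext <;> simp }

theorem imQuatL_apply (v : E3) : imQuatL v = imQuat v := rfl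

theorem imQuat_smul (c : ℝ) (v : E3) : imQuat (c • v) = c • imQuat v :=
  imQuatL.map_smul c v

theorem contDiff_cross : ContDiff ℝ 1 fun x : E3 × E3 ↦ cross x.1 x.2 := by
  rw [contDiff_euclidean]
  intro i
  have h : ∀ i, ContDiff ℝ 1 fun v : E3 ↦ v i := fun i ↦
    (EuclideanSpace.proj (𝕜 := ℝ) i : E3 →L[ℝ] ℝ).contDiff
  have h1 : ∀ i, ContDiff ℝ 1 fun x : E3 × E3 ↦ x.1 i := fun i ↦ (h i).comp contDiff_fst
  have h2 : ∀ i, ContDiff ℝ 1 fun x : E3 × E3 ↦ x.2 i := fun i ↦ (h i).comp contDiff_snd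
  fin_cases i
  · simpa using! ((h1 1).mul (h2 2)).sub ((h1 2).mul (h2 1))
  · simpa using! ((h1 2).mul (h2 0)).sub ((h1 0).mul (h2 2))
  · simpa using! ((h1 0).mul (h2 1)).sub ((h1 1).mul (h2 0))

theorem contDiffAt_dihedral {x : E3 × E3} (hx : 0 < 1 + inner ℝ x.1 x.2) :
    ContDiffAt ℝ 1 (fun x : E3 × E3 ↦ dihedral x.1 x.2) x := by
  have hi : ContDiffAt ℝ 1 (fun x : E3 × E3 ↦ inner ℝ x.1 x.2) x :=
    contDiffAt_fst.inner ℝ contDiffAt_snd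
  have hs : ContDiffAt ℝ 1 (fun x : E3 × E3 ↦ √(2 + 2 * inner ℝ x.1 x.2)) x :=
    (contDiffAt_const.add (contDiffAt_const.mul hi)).sqrt (by linarith)
  have hs0 : √(2 + 2 * inner ℝ x.1 x.2) ≠ 0 := (Real.sqrt_pos.2 (by linarith)).ne'
  have e : (fun x : E3 × E3 ↦ dihedral x.1 x.2) = fun x ↦
      (√(2 + 2 * inner ℝ x.1 x.2) / 2) • (1 : ℍ[ℝ]) +
        (√(2 + 2 * inner ℝ x.1 x.2))⁻¹ • imQuatL (cross x.1 x.2) := by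
    ext1 x
    rw [dihedral_eq, imQuatL_apply, ← Algebra.algebraMap_eq_smul_one, Quaternion.algebraMap_def]
  rw [e]
  exact ((hs.div_const 2).smul contDiffAt_const).add
    ((hs.inv hs0).smul (imQuatL.contDiff.contDiffAt.comp x contDiff_cross.contDiffAt))

theorem one_add_inner_pos_of_dist_lt {p p' : E3} (hp : p ∈ S2) (hp' : p' ∈ S2)
    (h : dist p p' < 1) : 0 < 1 + inner ℝ p p' := by
  refine one_add_inner_pos hp hp' ?_
  rintro rfl
  rw [mem_sphere_zero_iff_norm] at hp
  rw [dist_eq_norm, sub_neg_eq_add, ← two_smul ℝ, norm_smul, hp] at h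
  norm_num at h

/-- A Lipschitz map from the disk to `S²` has a Lipschitz lift through the Hopf fibration. -/
theorem exists_lipschitz_hopf_lift {S : ℂ → E3} {K : NNReal}
    (hS : LipschitzOnWith K S (Metric.closedBall 0 1))
    (hm : MapsTo S (Metric.closedBall 0 1) S2) :
    ∃ Q : ℂ → ℍ[ℝ], (∃ K, LipschitzOnWith K Q (Metric.closedBall 0 1)) ∧
      ∀ z ∈ Metric.closedBall 0 1, Q z ∈ hopfFibre (S z) := by
  have hc : IsCompact (Metric.closedBall (0 : ℂ) 1) := isCompact_closedBall _ _
  -- With N > K, the values of S at jz/N and (j+1)z/N are less than 1 apart, hence never antipodal.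
  obtain ⟨N, hN⟩ := exists_nat_gt (K : ℝ)
  have hN0 : (0 : ℝ) < N := K.coe_nonneg.trans_lt hN
  have scale : ∀ j : ℕ, j ≤ N → MapsTo (fun z : ℂ ↦ ((j : ℝ) / N) • z)
      (Metric.closedBall 0 1) (Metric.closedBall 0 1) := by
    intro j hj z hz
    rw [mem_closedBall_zero_iff] at hz ⊢
    rw [norm_smul, Real.norm_of_nonneg (by positivity)]
    exact mul_le_one₀ (div_le_one_of_le₀ (by exact_mod_cast hj) hN0.le) (norm_nonneg _) hz
  have hSj : ∀ j : ℕ, j ≤ N →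
      ∃ K, LipschitzOnWith K (fun z ↦ S (((j : ℝ) / N) • z)) (Metric.closedBall 0 1) :=
    fun j hj ↦ ⟨_, hS.comp (lipschitzWith_smul ((j : ℝ) / N)).lipschitzOnWith (scale j hj)⟩
  -- Lift the contraction z ↦ S(jz/N) by induction on j: it is constant for j = 0 and is S for j =
  -- N, and a dihedral factor passes from one stage to the next.
  suffices H : ∀ j : ℕ, j ≤ N → ∃ Q : ℂ → ℍ[ℝ],
      (∃ K, LipschitzOnWith K Q (Metric.closedBall 0 1)) ∧
      ∀ z ∈ Metric.closedBall 0 1, Q z ∈ hopfFibre (S (((j : ℝ) / N) • z)) by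
    obtain ⟨Q, h1, h2⟩ := H N le_rfl
    exact ⟨Q, h1, by simpa [div_self hN0.ne'] using h2⟩
  intro j
  induction j with
  | zero =>
    intro _
    obtain ⟨q, hq⟩ := hopfFibre_nonempty (hm (Metric.mem_closedBall_self zero_le_one))
    exact ⟨fun _ ↦ q, ⟨0, LipschitzWith.const q |>.lipschitzOnWith⟩, by simpa using fun _ _ ↦ hq⟩
  | succ j ih =>
    intro hj
    obtain ⟨Q, hQ, hQf⟩ := ih (by omega)
    have near : ∀ z ∈ Metric.closedBall (0 : ℂ) 1,
        0 < 1 + inner ℝ (S (((j : ℝ) / N) • z)) (S ((((j + 1 : ℕ) : ℝ) / N) • z)) := by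
      intro z hz
      have m1 := scale j (by omega) hz
      have m2 := scale (j + 1) hj hz
      refine one_add_inner_pos_of_dist_lt (hm m1) (hm m2) ?_
      refine (hS.dist_le_mul _ m1 _ m2).trans_lt ?_
      rw [mem_closedBall_zero_iff] at hz
      rw [dist_eq_norm, ← sub_smul, norm_smul, ← sub_div]
      push_cast
      rw [sub_add_cancel_left, norm_div, norm_neg, norm_one, Real.norm_of_nonneg hN0.le]
      calc (K : ℝ) * (1 / N * ‖z‖) ≤ K * (1 / N * 1) := by gcongr
        _ = K / N := by ring
        _ < 1 := (div_lt_one hN0).2 hN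
    obtain ⟨_, hp⟩ := LipschitzOnWith.exists_prodMk (hSj j (by omega)) (hSj (j + 1) hj)
    have hD := hp.exists_comp_of_contDiffAt hc
      (Φ := fun x : E3 × E3 ↦ dihedral x.1 x.2) fun z hz ↦ contDiffAt_dihedral (near z hz)
    obtain ⟨_, hDQ⟩ := LipschitzOnWith.exists_prodMk hD hQ
    refine ⟨_, hDQ.exists_comp_of_contDiffAt hc (Φ := fun x : ℍ[ℝ] × ℍ[ℝ] ↦ x.1 * x.2)
      fun z _ ↦ contDiff_mul.contDiffAt, fun z hz ↦ ?_⟩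
    exact dihedral_mul_mem_hopfFibre (hm (scale j (by omega) hz)) (hm (scale (j + 1) hj hz))
      (near z hz) (hQf z hz)

/-! ### Polar coordinates as a globally Lipschitz map onto the disk. -/

/-- Polar coordinates on the closed unit disk, with the radius clamped to `[0, 1]`. -/
noncomputable def clampedPolar (x : ℝ × ℝ) : ℂ :=
  ((max 0 (min x.1 1) : ℝ) : ℂ) * Complex.exp (x.2 * Complex.I)

theorem norm_clampedPolar (x : ℝ × ℝ) : ‖clampedPolar x‖ = max 0 (min x.1 1) := by
  rw [clampedPolar, norm_mul, Complex.norm_exp_ofReal_mul_I, mul_one, Complex.norm_real,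
    Real.norm_of_nonneg (le_max_left _ _)]

theorem clampedPolar_mem (x : ℝ × ℝ) : clampedPolar x ∈ Metric.closedBall (0 : ℂ) 1 := by
  rw [mem_closedBall_zero_iff, norm_clampedPolar]
  exact max_le zero_le_one (min_le_right _ _)

/-- Clamping is 1-Lipschitz in the radius, and it bounds by 1 the factor multiplying an angular
displacement. -/
theorem lipschitzWith_clampedPolar : ∃ K, LipschitzWith K clampedPolar := by
  refine ⟨2, LipschitzWith.of_dist_le_mul fun x y ↦ ?_⟩
  set r := max 0 (min x.1 1)
  set s := max 0 (min y.1 1)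
  have hs : |s| ≤ 1 := by
    rw [abs_of_nonneg (le_max_left _ _)]; exact max_le zero_le_one (min_le_right _ _)
  have hrs : |r - s| ≤ |x.1 - y.1| := by
    have h1 := abs_max_sub_max_le_max 0 (min x.1 1) 0 (min y.1 1)
    have h2 := abs_min_sub_min_le_max x.1 1 y.1 1
    simp only [sub_self, abs_zero, abs_nonneg, sup_of_le_left, sup_of_le_right] at h1 h2
    exact h1.trans h2
  have he : ‖Complex.exp (x.2 * Complex.I) - Complex.exp (y.2 * Complex.I)‖ ≤ |x.2 - y.2| := by
    have h1 : Complex.exp (x.2 * Complex.I) - Complex.exp (y.2 * Complex.I) =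
        Complex.exp (y.2 * Complex.I) *
          (Complex.exp (Complex.I * ((x.2 - y.2 : ℝ) : ℂ)) - 1) := by
      rw [mul_sub, ← Complex.exp_add, mul_one]
      congr 2
      push_cast
      ring
    rw [h1, norm_mul, Complex.norm_exp_ofReal_mul_I, one_mul]
    exact Real.norm_exp_I_mul_ofReal_sub_one_le
  have : clampedPolar x - clampedPolar y = ((r - s : ℝ) : ℂ) * Complex.exp (x.2 * Complex.I) +
      (s : ℂ) * (Complex.exp (x.2 * Complex.I) - Complex.exp (y.2 * Complex.I)) := by
    simp only [clampedPolar]; push_cast; ring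
  rw [dist_eq_norm, this]
  refine (norm_add_le _ _).trans ?_
  rw [norm_mul, norm_mul, Complex.norm_exp_ofReal_mul_I, mul_one, Complex.norm_real,
    Complex.norm_real, Real.norm_eq_abs, Real.norm_eq_abs]
  have h1 : |x.1 - y.1| ≤ dist x y := by rw [Prod.dist_eq, Real.dist_eq]; exact le_max_left _ _
  have h2 : |x.2 - y.2| ≤ dist x y := by
    rw [Prod.dist_eq, Real.dist_eq, Real.dist_eq]; exact le_max_right _ _
  have h3 := mul_le_mul hs he (norm_nonneg _) zero_le_one
  simp only [NNReal.coe_ofNat]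
  linarith

theorem clampedPolar_of_mem {r : ℝ} (hr : r ∈ Icc (0 : ℝ) 1) (t : ℝ) :
    clampedPolar (r, t) = r * Complex.exp (t * Complex.I) := by
  simp [clampedPolar, hr.1, hr.2]

/-- A bounded Lipschitz function on the disk gives a function on the strip. -/
theorem isPolarStrip_comp_clampedPolar {g : ℂ → ℝ}
    (hg : ∃ K, LipschitzOnWith K g (Metric.closedBall 0 1))
    (hb : ∃ M, ∀ z ∈ Metric.closedBall 0 1, |g z| ≤ M) :
    IsPolarStrip (-Real.pi) Real.pi fun x ↦ g (clampedPolar x) := by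
  obtain ⟨K, hK⟩ := hg
  obtain ⟨L, hL⟩ := lipschitzWith_clampedPolar
  obtain ⟨M, hM⟩ := hb
  refine ⟨⟨K * L, ?_⟩, ⟨M, fun x ↦ hM _ (clampedPolar_mem x)⟩, fun r ↦ ?_, fun r t hr ↦ ?_,
    fun r t hr ↦ ?_⟩
  · rw [← lipschitzOnWith_univ]
    exact hK.comp hL.lipschitzOnWith fun x _ ↦ clampedPolar_mem x
  · simp [clampedPolar, Complex.exp_neg, Complex.exp_pi_mul_I]
  · simp [clampedPolar, min_le_of_left_le hr]
  · simp [clampedPolar, hr]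

/-! ### The connection form and the phase of a curve relative to a horizontal lift. -/

instance : StarModule ℝ ℍ[ℝ] := ⟨fun r q ↦ by rw [Quaternion.star_smul, star_trivial r]⟩

/-- The complex part `w + x i` of a quaternion. -/
noncomputable def complexPart : ℍ[ℝ] →L[ℝ] ℂ :=
  LinearMap.toContinuousLinearMap
    { toFun := fun q ↦ ⟨q.re, q.imI⟩
      map_add' := fun _ _ ↦ by apply Complex.ext <;> simp
      map_smul' := fun _ _ ↦ by apply Complex.ext <;> simp }

@[simp] theorem complexPart_re (q : ℍ[ℝ]) : (complexPart q).re = q.re := rfl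
@[simp] theorem complexPart_im (q : ℍ[ℝ]) : (complexPart q).im = q.imI := rfl

/-- The components of a quaternion as continuous linear maps. -/
noncomputable def reL : ℍ[ℝ] →L[ℝ] ℝ := Complex.reCLM.comp complexPart
noncomputable def imIL : ℍ[ℝ] →L[ℝ] ℝ := Complex.imCLM.comp complexPart
noncomputable def imJL : ℍ[ℝ] →L[ℝ] ℝ :=
  LinearMap.toContinuousLinearMap
    { toFun := fun q ↦ q.imJ, map_add' := fun _ _ ↦ by simp, map_smul' := fun _ _ ↦ by simp }
noncomputable def imKL : ℍ[ℝ] →L[ℝ] ℝ :=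
  LinearMap.toContinuousLinearMap
    { toFun := fun q ↦ q.imK, map_add' := fun _ _ ↦ by simp, map_smul' := fun _ _ ↦ by simp }

theorem reL_apply (q : ℍ[ℝ]) : reL q = q.re := rfl
theorem imIL_apply (q : ℍ[ℝ]) : imIL q = q.imI := rfl
theorem imJL_apply (q : ℍ[ℝ]) : imJL q = q.imJ := rfl
theorem imKL_apply (q : ℍ[ℝ]) : imKL q = q.imK := rfl

theorem normSq_eq_one {q : ℍ[ℝ]} (hq : ‖q‖ = 1) :
    q.re ^ 2 + q.imI ^ 2 + q.imJ ^ 2 + q.imK ^ 2 = 1 := by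
  rw [← Quaternion.normSq_def', Quaternion.normSq_eq_norm_mul_self, hq, one_mul]

theorem abs_components_le_one {q : ℍ[ℝ]} (hq : ‖q‖ = 1) :
    |reL q| ≤ 1 ∧ |imIL q| ≤ 1 ∧ |imJL q| ≤ 1 ∧ |imKL q| ≤ 1 := by
  have := normSq_eq_one hq
  simp only [reL_apply, imIL_apply, imJL_apply, imKL_apply, ← sq_le_one_iff_abs_le_one]
  refine ⟨?_, ?_, ?_, ?_⟩ <;> nlinarith [sq_nonneg q.re, sq_nonneg q.imI, sq_nonneg q.imJ,
    sq_nonneg q.imK]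

/-- The connection form of the Hopf fibration along a curve `γ`: the `i`-component of `γ̄ γ'`. -/
noncomputable def hopfConnection (γ : ℝ → ℍ[ℝ]) (t : ℝ) : ℝ :=
  reL (γ t) * deriv (fun s ↦ imIL (γ s)) t - imIL (γ t) * deriv (fun s ↦ reL (γ s)) t -
    imJL (γ t) * deriv (fun s ↦ imKL (γ s)) t + imKL (γ t) * deriv (fun s ↦ imJL (γ s)) t

theorem hopfConnection_eq {γ : ℝ → ℍ[ℝ]} {γ' : ℍ[ℝ]} {t : ℝ} (h : HasDerivAt γ γ' t) :
    hopfConnection γ t = (star (γ t) * γ').imI := by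
  have d : ∀ L : ℍ[ℝ] →L[ℝ] ℝ, deriv (fun s ↦ L (γ s)) t = L γ' := fun L ↦
    (L.hasFDerivAt.comp_hasDerivAt t h).deriv
  rw [hopfConnection, d, d, d, d]
  simp [reL_apply, imIL_apply, imJL_apply, imKL_apply]
  ring

theorem re_star_mul_deriv {γ : ℝ → ℍ[ℝ]} {γ' : ℍ[ℝ]} {t : ℝ} (h : HasDerivAt γ γ' t)
    (h1 : ∀ᶠ s in 𝓝 t, ‖γ s‖ = 1) : (star (γ t) * γ').re = 0 := by
  have h2 : HasDerivAt (fun s ↦ star (γ s) * γ s) (star γ' * γ t + star (γ t) * γ') t :=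
    h.star.mul h
  have h3 : (fun s ↦ star (γ s) * γ s) =ᶠ[𝓝 t] fun _ ↦ 1 :=
    h1.mono fun s hs ↦ star_mul_self_of_norm_eq_one hs
  have h4 := congrArg (fun q : ℍ[ℝ] ↦ q.re)
    (h2.unique ((hasDerivAt_const t (1 : ℍ[ℝ])).congr_of_eventuallyEq h3))
  simp at h4 ⊢
  linarith

/-- Two points of the same Hopf fibre differ by a complex phase. -/
theorem star_mul_imJ_imK {q q' : ℍ[ℝ]} (hq : ‖q‖ = 1) (hq' : ‖q'‖ = 1)
    (h : q * quatI * star q = q' * quatI * star q') :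
    (star q * q').imJ = 0 ∧ (star q * q').imK = 0 := by
  have h1 : quatI * (star q * q') = star q * q' * quatI := by
    calc quatI * (star q * q') = star q * q * quatI * (star q * q') := by
          rw [star_mul_self_of_norm_eq_one hq, one_mul]
      _ = star q * (q * quatI * star q) * q' := by noncomm_ring
      _ = star q * q' * quatI * (star q' * q') := by rw [h]; noncomm_ring
      _ = star q * q' * quatI := by rw [star_mul_self_of_norm_eq_one hq', mul_one]
  generalize star q * q' = U at h1
  have hj := congrArg (fun q : ℍ[ℝ] ↦ q.imJ) h1
  have hk := congrArg (fun q : ℍ[ℝ] ↦ q.imK) h1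
  simp only [Quaternion.imJ_mul, Quaternion.imK_mul, quatI_re, quatI_imI, quatI_imJ,
    quatI_imK] at hj hk
  constructor <;> linarith

/-- The phase of a curve relative to a horizontal curve over the same base curve changes at the
rate of the connection form. -/
theorem complexPart_deriv {H H' γ γ' : ℍ[ℝ]} (hH : ‖H‖ = 1) (hγ : ‖γ‖ = 1)
    (h : H * quatI * star H = γ * quatI * star γ) (hH' : (star H * H').re = 0)
    (hor : (star H * H').imI = 0) (hγ' : (star γ * γ').re = 0) :
    complexPart (star H' * γ + star H * γ') =
      complexPart (star H * γ) * ((star γ * γ').imI * Complex.I) := by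
  obtain ⟨uj, uk⟩ := star_mul_imJ_imK hH hγ h
  have e1 : star H' = -(star H * H') * star H := by
    have : star (star H * H') = -(star H * H') := by rw [Quaternion.star_eq_neg]; exact hH'
    rw [← this, star_mul, star_star, mul_assoc, mul_star_self_of_norm_eq_one hH, mul_one]
  have e2 : γ' = γ * (star γ * γ') := by
    rw [← mul_assoc, mul_star_self_of_norm_eq_one hγ, one_mul]
  generalize hη : star H * H' = η at *
  generalize hξ : star γ * γ' = ξ at *
  -- Here H̄γ is complex and η is a combination of j and k, so the first summand has no complex
  -- part; in the second only the i-component of ξ contributes.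
  have e3 : star H' * γ + star H * γ' = -η * (star H * γ) + (star H * γ) * ξ := by
    rw [e1, e2]; noncomm_ring
  rw [e3]
  generalize star H * γ = U at *
  apply Complex.ext <;> simp [uj, uk, hH', hor, hγ']

/-- Conjugation is orthogonal, so the i-component of q̄wq is the inner product of w with q i q̄ = p.
This makes left rotation of q about an axis w orthogonal to p horizontal. -/
theorem imI_conj {p w : E3} {q : ℍ[ℝ]} (hq : q ∈ hopfFibre p) (hw : inner ℝ p w = 0) :
    (star q * imQuat w * q).imI = 0 := by
  have h1 : ((q * quatI * star q) * imQuat w).re = -(star q * imQuat w * q).imI := by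
    simp; ring
  rw [hq.2] at h1
  rw [inner_E3] at hw
  simp only [Quaternion.re_mul, imQuat_re, imQuat_imI, imQuat_imJ, imQuat_imK] at h1
  linarith

section Holonomy

variable {γ : ℝ → ℍ[ℝ]} {K : NNReal}

theorem intervalIntegrable_hopfConnection (hγ : LipschitzWith K γ) (u v : ℝ) :
    IntervalIntegrable (hopfConnection γ) volume u v := by
  have ac : ∀ L : ℍ[ℝ] →L[ℝ] ℝ, AbsolutelyContinuousOnInterval (fun s ↦ L (γ s)) u v :=
    fun L ↦ (L.lipschitz.comp hγ).lipschitzOnWith.absolutelyContinuousOnInterval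
  have i : ∀ L M : ℍ[ℝ] →L[ℝ] ℝ,
      IntervalIntegrable (fun t ↦ L (γ t) * deriv (fun s ↦ M (γ s)) t) volume u v :=
    fun L M ↦ (ac M).intervalIntegrable_deriv.continuousOn_mul (ac L).continuousOn
  exact (((i reL imIL).sub (i imIL reL)).sub (i imJL imKL)).add (i imKL imJL)

theorem exists_bound_hopfConnection (hγ : LipschitzWith K γ) (h1 : ∀ t, ‖γ t‖ = 1) :
    ∃ M, ∀ t, ‖hopfConnection γ t‖ ≤ M := by
  have d : ∀ (L : ℍ[ℝ] →L[ℝ] ℝ) t, |deriv (fun s ↦ L (γ s)) t| ≤ ‖L‖ * K := fun L t ↦ by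
    simpa using! norm_deriv_le_of_lipschitz (L.lipschitz.comp hγ) (x₀ := t)
  refine ⟨‖imIL‖ * K + ‖reL‖ * K + ‖imKL‖ * K + ‖imJL‖ * K, fun t ↦ ?_⟩
  obtain ⟨c1, c2, c3, c4⟩ := abs_components_le_one (h1 t)
  have m : ∀ {x y z : ℝ}, |x| ≤ 1 → |y| ≤ z → |x * y| ≤ z := fun hx hy ↦ by
    rw [abs_mul]
    exact (mul_le_of_le_one_left (abs_nonneg _) hx).trans hy
  have m1 := abs_le.1 (m c1 (d imIL t))
  have m2 := abs_le.1 (m c2 (d reL t))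
  have m3 := abs_le.1 (m c3 (d imKL t))
  have m4 := abs_le.1 (m c4 (d imJL t))
  rw [Real.norm_eq_abs, abs_le, hopfConnection]
  constructor <;> linarith [m1.1, m1.2, m2.1, m2.2, m3.1, m3.2, m4.1, m4.2]

/-- Comparison of a Lipschitz curve of unit quaternions with a horizontal curve lying over the same
great-circle arc. -/
theorem complexPart_holonomy (hγ : LipschitzWith K γ) (h1 : ∀ t, ‖γ t‖ = 1) {u v : ℝ}
    (huv : u ≤ v) {α β : ℝ → ℝ} (hα : ∃ K, LipschitzOnWith K α (Icc u v))
    (hβ : ∃ K, LipschitzOnWith K β (Icc u v)) {p w : E3} {q : ℍ[ℝ]} (hq : q ∈ hopfFibre p)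
    (hw : inner ℝ p w = 0) {H : ℝ → ℍ[ℝ]}
    (hH : ∀ t, H t = (α t • (1 : ℍ[ℝ]) + β t • imQuat w) * q)
    (hH1 : ∀ t ∈ Icc u v, ‖H t‖ = 1)
    (hHγ : ∀ t ∈ Icc u v, H t * quatI * star (H t) = γ t * quatI * star (γ t)) :
    complexPart (star (H v) * γ v) = complexPart (star (H u) * γ u) *
      Complex.exp ((∫ t in u..v, hopfConnection γ t : ℝ) * Complex.I) := by
  set φ : ℝ → ℝ := fun t ↦ ∫ s in u..t, hopfConnection γ s with hφ
  have iω := intervalIntegrable_hopfConnection hγ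
  obtain ⟨M, hM⟩ := exists_bound_hopfConnection hγ h1
  have hM0 : 0 ≤ M := (norm_nonneg _).trans (hM 0)
  have lφ : LipschitzWith ⟨M, hM0⟩ φ := LipschitzWith.of_dist_le_mul fun x y ↦ by
    rw [dist_eq_norm, hφ, intervalIntegral.integral_interval_sub_left (iω _ _) (iω _ _),
      Real.dist_eq]
    exact intervalIntegral.norm_integral_le_of_norm_le_const fun t _ ↦ hM t
  -- The relative phase with its expected growth divided out. It is Lipschitz with zero derivative
  -- almost everywhere, hence constant on [u, v].
  set V : ℝ → ℂ := fun t ↦ complexPart (star (H t) * γ t) * Complex.exp (-(φ t * Complex.I))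
    with hV
  have lV : ∃ K, LipschitzOnWith K V (Icc u v) := by
    obtain ⟨_, l⟩ := LipschitzOnWith.exists_prodMk (LipschitzOnWith.exists_prodMk hα hβ)
      (LipschitzOnWith.exists_prodMk ⟨_, hγ.lipschitzOnWith⟩ ⟨_, lφ.lipschitzOnWith⟩)
    set Φ : (ℝ × ℝ) × (ℍ[ℝ] × ℝ) → ℂ := fun x ↦
      complexPart (starL' ℝ ((x.1.1 • (1 : ℍ[ℝ]) + x.1.2 • imQuat w) * q) * x.2.1) *
        Complex.exp (-(Complex.ofRealCLM x.2.2 * Complex.I)) with hΦ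
    have e : V = fun t ↦ Φ ((α t, β t), (γ t, φ t)) := by
      funext t
      simp [hV, hΦ, hH, starL']
    have cΦ : ContDiff ℝ 1 Φ := by
      rw [hΦ]
      fun_prop
    rw [e]
    exact l.exists_comp_of_contDiffAt isCompact_Icc fun x _ ↦ cΦ.contDiffAt
  have hV0 : ∀ᵐ x, x ∈ uIcc u v → HasDerivAt V 0 x := by
    obtain ⟨_, lα⟩ := hα
    obtain ⟨_, lβ⟩ := hβ
    rw [← uIcc_of_le huv] at lα lβ
    -- H is unit only on [u, v], and differentiating that constraint needs a neighbourhood of x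
    -- inside the interval.
    have endpoints : ∀ᵐ x : ℝ, x ≠ u ∧ x ≠ v := by
      filter_upwards [(measure_eq_zero_iff_ae_notMem.1 (measure_singleton u)),
        (measure_eq_zero_iff_ae_notMem.1 (measure_singleton v))] with x h1 h2
      exact ⟨h1, h2⟩
    filter_upwards [lα.absolutelyContinuousOnInterval.ae_differentiableAt,
      lβ.absolutelyContinuousOnInterval.ae_differentiableAt,
      hγ.ae_differentiableAt, (iω u v).ae_hasDerivAt_integral, endpoints]
      with x xα xβ xγ xφ xe hx
    have dγ := xγ.hasDerivAt
    have dφ := xφ hx u (by simp)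
    have dH : HasDerivAt H ((deriv α x • (1 : ℍ[ℝ]) + deriv β x • imQuat w) * q) x := by
      rw [show H = fun t ↦ (α t • (1 : ℍ[ℝ]) + β t • imQuat w) * q from funext hH]
      exact ((((xα hx).hasDerivAt.smul_const _).add ((xβ hx).hasDerivAt.smul_const _)).mul_const q)
    rw [uIcc_of_le huv] at hx
    have hnear : ∀ᶠ t in 𝓝 x, t ∈ Icc u v :=
      Icc_mem_nhds (lt_of_le_of_ne hx.1 (Ne.symm xe.1)) (lt_of_le_of_ne hx.2 xe.2)
    have rH := re_star_mul_deriv dH (hnear.mono hH1)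
    have rγ := re_star_mul_deriv dγ (.of_forall h1)
    -- Expanding H̄H' gives real terms, because w² is real, plus a multiple of q̄wq, whose
    -- i-component vanishes.
    have hor : (star (H x) * ((deriv α x • (1 : ℍ[ℝ]) + deriv β x • imQuat w) * q)).imI = 0 := by
      have sw : star (imQuat w) = -imQuat w := by rw [Quaternion.star_eq_neg]; rfl
      have sq : star q * q = 1 := star_mul_self_of_norm_eq_one hq.1
      have sww : star q * (imQuat w * imQuat w) * q =
          ((-(w 0 ^ 2 + w 1 ^ 2 + w 2 ^ 2) : ℝ) : ℍ[ℝ]) := by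
        have : imQuat w * imQuat w = ((-(w 0 ^ 2 + w 1 ^ 2 + w 2 ^ 2) : ℝ) : ℍ[ℝ]) := by
          ext <;>
            simp only [Quaternion.re_mul, Quaternion.imI_mul, Quaternion.imJ_mul,
              Quaternion.imK_mul, imQuat_re, imQuat_imI, imQuat_imJ, imQuat_imK,
              Quaternion.re_coe, Quaternion.imI_coe, Quaternion.imJ_coe, Quaternion.imK_coe] <;>
            ring
        rw [this, ← Quaternion.coe_commutes, mul_assoc, sq, mul_one]
      have e : star (H x) * ((deriv α x • (1 : ℍ[ℝ]) + deriv β x • imQuat w) * q) =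
          (α x * deriv α x) • (star q * q) + (α x * deriv β x - β x * deriv α x) •
            (star q * imQuat w * q) - (β x * deriv β x) •
              (star q * (imQuat w * imQuat w) * q) := by
        rw [hH, star_mul, star_add, star_smul, star_smul, sw, star_one]
        simp only [star_trivial, add_mul, mul_add, smul_mul_assoc, mul_smul_comm, smul_neg,
          neg_mul, mul_neg, one_mul, mul_assoc]
        module
      rw [e, sww, sq]
      simp only [Quaternion.imI_sub, Quaternion.imI_add, Quaternion.imI_smul, imI_conj hq hw,
        Quaternion.imI_coe, Quaternion.imI_one]
      simp
    have key := complexPart_deriv (hH1 x hx) (h1 x) (hHγ x hx) rH hor rγ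
    rw [← hopfConnection_eq dγ] at key
    have dU := complexPart.hasFDerivAt.comp_hasDerivAt x (dH.star.mul dγ)
    have dE : HasDerivAt (fun t ↦ Complex.exp (-(φ t * Complex.I)))
        (Complex.exp (-(φ x * Complex.I)) * -(hopfConnection γ x * Complex.I)) x :=
      ((dφ.ofReal_comp.mul_const Complex.I).neg).cexp
    have dV := dU.mul dE
    rw [key] at dV
    convert! dV using 1
    simp only [Function.comp, Pi.mul_apply]
    ring
  obtain ⟨_, lV⟩ := lV
  rw [← uIcc_of_le huv] at lV
  obtain ⟨C, hC⟩ := lV.absolutelyContinuousOnInterval.const_of_ae_hasDerivAt_zero hV0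
  have e := (hC v (by simp)).trans (hC u (by simp)).symm
  simp only [hV, hφ, intervalIntegral.integral_same, Complex.ofReal_zero, zero_mul, neg_zero,
    Complex.exp_zero, mul_one] at e
  rw [← e, mul_assoc, ← Complex.exp_add, neg_add_cancel, Complex.exp_zero, mul_one]

end Holonomy

/-! ### The area as a boundary integral of the connection form. -/

/-- Change of variables for the indicator of a null set gives integral zero, and the Jacobian r is
positive, so the preimage is null. This transports Rademacher's theorem for S to polar coordinates.
-/
theorem ae_comp_polarCoord_symm {P : ℂ → Prop} (h : ∀ᵐ z, P z) :
    ∀ᵐ x ∂(volume.restrict polarCoord.target), P (Complex.polarCoord.symm x) := by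
  obtain ⟨N, hN, mN, N0⟩ := exists_measurable_superset_of_null (ae_iff.1 h)
  have mp : Measurable fun x : ℝ × ℝ ↦ Complex.polarCoord.symm x := by
    simp only [Complex.polarCoord_symm_apply]
    fun_prop
  have e := Complex.lintegral_comp_polarCoord_symm (N.indicator fun _ ↦ 1)
  have mi : Measurable fun x : ℝ × ℝ ↦ ENNReal.ofReal x.1 •
      N.indicator (fun _ ↦ (1 : ENNReal)) (Complex.polarCoord.symm x) :=
    (by fun_prop : Measurable fun x : ℝ × ℝ ↦ ENNReal.ofReal x.1).smul
      ((measurable_const.indicator mN).comp mp)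
  rw [lintegral_indicator_const mN, N0, mul_zero, lintegral_eq_zero_iff mi] at e
  filter_upwards [e, ae_restrict_mem polarCoord.open_target.measurableSet] with x hx hxt
  by_contra hP
  have hxN : Complex.polarCoord.symm x ∈ N := hN hP
  simp only [hxN, indicator_of_mem, smul_eq_mul, mul_one, Pi.zero_apply,
    ENNReal.ofReal_eq_zero] at hx
  rw [polarCoord_target] at hxt
  exact absurd hxt.1 (not_lt.2 hx)

theorem areaForm_linearComb (x u v : E3) (a b c d : ℝ) :
    areaForm x (a • u + b • v) (c • u + d • v) = (a * d - b * c) * areaForm x u v := by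
  simp [areaForm, inner_E3]
  ring

theorem setIntegral_ball_eq_polar (g : ℂ → ℝ) :
    ∫ z in Metric.ball (0 : ℂ) 1, g z =
      ∫ x in Ioo (0 : ℝ) 1 ×ˢ Ioo (-Real.pi) Real.pi, x.1 * g (clampedPolar x) := by
  rw [← integral_indicator Metric.isOpen_ball.measurableSet,
    ← Complex.integral_comp_polarCoord_symm]
  have hsub : Ioo (0 : ℝ) 1 ×ˢ Ioo (-Real.pi) Real.pi ⊆ polarCoord.target := by
    rw [polarCoord_target]
    exact prod_mono Ioo_subset_Ioi_self subset_rfl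
  refine (setIntegral_eq_of_subset_of_forall_sdiff_eq_zero
    polarCoord.open_target.measurableSet hsub ?_).trans ?_
  swap
  · refine setIntegral_congr_fun (measurableSet_Ioo.prod measurableSet_Ioo) ?_
    rintro ⟨r, t⟩ ⟨hr, -⟩
    have e : Complex.polarCoord.symm (r, t) = clampedPolar (r, t) := by
      rw [clampedPolar_of_mem ⟨hr.1.le, hr.2.le⟩, Complex.polarCoord_symm_apply,
        Complex.exp_mul_I, Complex.ofReal_cos, Complex.ofReal_sin]
    have hm : clampedPolar (r, t) ∈ Metric.ball (0 : ℂ) 1 := by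
      rw [mem_ball_zero_iff, ← e, Complex.norm_polarCoord_symm, abs_of_pos hr.1]
      exact hr.2
    simp only [e, indicator_of_mem hm, smul_eq_mul]
  · rintro x ⟨hx, hxn⟩
    rw [polarCoord_target] at hx
    rw [indicator_of_notMem, smul_zero]
    rw [mem_ball_zero_iff, Complex.norm_polarCoord_symm, abs_of_pos hx.1]
    exact fun h ↦ hxn ⟨⟨hx.1, h⟩, hx.2⟩

theorem ae_differentiableAt_clampedPolar {S : ℂ → E3} {K : NNReal}
    (hS : LipschitzOnWith K S (Metric.closedBall 0 1)) :
    ∀ᵐ x ∂(volume.restrict (Ioo (0 : ℝ) 1 ×ˢ Ioo (-Real.pi) Real.pi)),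
      DifferentiableAt ℝ S (clampedPolar x) := by
  have h := ae_comp_polarCoord_symm (hS.ae_differentiableWithinAt_of_mem (μ := volume))
  have hsub : Ioo (0 : ℝ) 1 ×ˢ Ioo (-Real.pi) Real.pi ⊆ polarCoord.target := by
    rw [polarCoord_target]
    exact prod_mono Ioo_subset_Ioi_self subset_rfl
  filter_upwards [ae_mono (Measure.restrict_mono hsub le_rfl) h,
    ae_restrict_mem (measurableSet_Ioo.prod measurableSet_Ioo)] with x hx hxm
  obtain ⟨r, t⟩ := x
  have hr := hxm.1
  have e : Complex.polarCoord.symm (r, t) = clampedPolar (r, t) := by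
    rw [clampedPolar_of_mem ⟨hr.1.le, hr.2.le⟩, Complex.polarCoord_symm_apply,
      Complex.exp_mul_I, Complex.ofReal_cos, Complex.ofReal_sin]
  have hm : clampedPolar (r, t) ∈ Metric.ball (0 : ℂ) 1 := by
    rw [mem_ball_zero_iff, ← e, Complex.norm_polarCoord_symm, abs_of_pos hr.1]
    exact hr.2
  rw [e] at hx
  exact (hx (Metric.ball_subset_closedBall hm)).differentiableAt
    (mem_of_superset (Metric.isOpen_ball.mem_nhds hm) Metric.ball_subset_closedBall)

/-- The pullback of the area form under `S`, in polar coordinates, in terms of a lift of `S`. -/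
theorem mul_pullbackArea_clampedPolar {S : ℂ → E3} {Q : ℂ → ℍ[ℝ]}
    (hQ : ∀ z ∈ Metric.closedBall 0 1, Q z ∈ hopfFibre (S z)) {r t : ℝ} (hr : r ∈ Ioo (0 : ℝ) 1)
    (hS : DifferentiableAt ℝ S (clampedPolar (r, t))) {Q' : ℝ × ℝ →L[ℝ] ℍ[ℝ]}
    (hQ' : HasFDerivAt (fun x ↦ Q (clampedPolar x)) Q' (r, t)) :
    r * pullbackArea S (clampedPolar (r, t)) = -4 * (star (Q' (1, 0)) * Q' (0, 1)).imI := by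
  set z := clampedPolar (r, t) with hz
  set L := fderiv ℝ S z with hL
  have unit : ∀ x, ‖Q (clampedPolar x)‖ = 1 := fun x ↦ (hQ _ (clampedPolar_mem x)).1
  have proj : ∀ x, S (clampedPolar x) =
      imVec (Q (clampedPolar x) * quatI * star (Q (clampedPolar x))) := fun x ↦ by
    rw [(hQ _ (clampedPolar_mem x)).2, imVec_imQuat]
  -- The derivative of S along a coordinate curve is computed twice, directly and through the lift;
  -- only Q in polar coordinates has to be differentiable.
  have curve : ∀ (c : ℝ → ℝ × ℝ) (c' : ℝ × ℝ) (ζ : ℂ) (s : ℝ), HasDerivAt c c' s → c s = (r, t) →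
      HasDerivAt (fun s ↦ clampedPolar (c s)) ζ s →
      (star (Q z) * Q' c').re = 0 ∧
      L ζ = imVec (Q' c' * quatI * star (Q z) + Q z * quatI * star (Q' c')) := by
    intro c c' ζ s hc hcs hζ
    have dQ : HasDerivAt (fun s ↦ Q (clampedPolar (c s))) (Q' c') s :=
      (show HasFDerivAt (fun x ↦ Q (clampedPolar x)) Q' (c s) by
        rwa [hcs]).comp_hasDerivAt s hc
    have dS : HasDerivAt (fun s ↦ S (clampedPolar (c s))) (L ζ) s :=
      (show HasFDerivAt S L (clampedPolar (c s)) by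
        rw [hcs]; exact hS.hasFDerivAt).comp_hasDerivAt s hζ
    have r0 := re_star_mul_deriv dQ (.of_forall fun s ↦ unit _)
    have dQQ := imVec.hasFDerivAt.comp_hasDerivAt s ((dQ.mul_const quatI).mul dQ.star)
    simp only [hcs] at r0 dQQ
    refine ⟨r0, dS.unique ?_⟩
    simp only [proj]
    exact dQQ
  obtain ⟨x0, xL⟩ := curve (fun ρ ↦ (ρ, t)) (1, 0) (Complex.exp (t * Complex.I)) r
    ((hasDerivAt_id r).prodMk (hasDerivAt_const r t)) rfl (by
      have h : (fun ρ : ℝ ↦ clampedPolar (ρ, t)) =ᶠ[𝓝 r]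
          fun ρ ↦ (ρ : ℂ) * Complex.exp (t * Complex.I) := by
        filter_upwards [Ioo_mem_nhds hr.1 hr.2] with ρ hρ
        exact clampedPolar_of_mem ⟨hρ.1.le, hρ.2.le⟩ t
      refine HasDerivAt.congr_of_eventuallyEq ?_ h
      simpa using (hasDerivAt_id r).ofReal_comp.mul_const (Complex.exp (t * Complex.I)))
  obtain ⟨y0, yL⟩ := curve (fun τ ↦ (r, τ)) (0, 1) (r * (Complex.exp (t * Complex.I) * Complex.I)) t
    ((hasDerivAt_const t r).prodMk (hasDerivAt_id t)) rfl (by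
      have h : (fun τ : ℝ ↦ clampedPolar (r, τ)) = fun τ : ℝ ↦
          (r : ℂ) * Complex.exp (τ * Complex.I) := by
        funext τ
        exact clampedPolar_of_mem ⟨hr.1.le, hr.2.le⟩ τ
      rw [h]
      simpa using ((((hasDerivAt_id t).ofReal_comp).mul_const Complex.I).cexp).const_mul (r : ℂ))
  have hopf := areaForm_hopf (hQ z (clampedPolar_mem _)).1 x0 y0
  rw [← xL, ← yL, (hQ z (clampedPolar_mem _)).2, imVec_imQuat] at hopf
  rw [← hopf, pullbackArea]
  have ex : Complex.exp (t * Complex.I) = Real.cos t • (1 : ℂ) + Real.sin t • Complex.I := by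
    rw [Complex.exp_mul_I]; simp
  have ey : (r : ℂ) * (Complex.exp (t * Complex.I) * Complex.I) =
      (-(r * Real.sin t)) • (1 : ℂ) + (r * Real.cos t) • Complex.I := by
    rw [ex]
    apply Complex.ext <;> simp
  rw [ey, ex, map_add, map_add, map_smul, map_smul, map_smul, map_smul, areaForm_linearComb]
  linear_combination -(r * areaForm (S z) (L 1) (L Complex.I)) * Real.sin_sq_add_cos_sq t

theorem IsPolarStrip.integrableOn_jacobian {α β : ℝ} {a b : ℝ × ℝ → ℝ} (ha : IsPolarStrip α β a)
    (hb : IsPolarStrip α β b) :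
    IntegrableOn (fun x ↦ lineDeriv ℝ a x (1, 0) * lineDeriv ℝ b x (0, 1) -
        lineDeriv ℝ a x (0, 1) * lineDeriv ℝ b x (1, 0)) (Ioo (0 : ℝ) 1 ×ˢ Ioo α β) := by
  obtain ⟨Ka, hKa⟩ := ha.lipschitz
  obtain ⟨Kb, hKb⟩ := hb.lipschitz
  have bound : ∀ {g : ℝ × ℝ → ℝ} {K : NNReal}, LipschitzWith K g → ∀ x (v : ℝ × ℝ), ‖v‖ = 1 →
      |lineDeriv ℝ g x v| ≤ K := fun {g K} h x v hv ↦ by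
    simpa [hv] using norm_lineDeriv_le_of_lipschitz ℝ h (x₀ := x) (v := v)
  refine (integrableOn_rect_of_bounded (M := Ka * Kb + Ka * Kb)
    (((ha.measurable_lineDeriv _).mul (hb.measurable_lineDeriv _)).sub
    ((ha.measurable_lineDeriv _).mul (hb.measurable_lineDeriv _))) (fun x ↦ ?_) 0 1 α β).mono_set
    (prod_mono Ioo_subset_Ioc_self Ioo_subset_Ioc_self)
  refine (abs_sub _ _).trans ?_
  simp only [Pi.mul_apply]
  rw [abs_mul, abs_mul]
  gcongr <;> first | exact bound hKa _ _ (by simp) | exact bound hKb _ _ (by simp)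

/-- The area of a Lipschitz map from the disk to `S²` in terms of the boundary values of a lift. -/
theorem integral_pullbackArea {S : ℂ → E3} {Q : ℂ → ℍ[ℝ]} {K L : NNReal}
    (hS : LipschitzOnWith K S (Metric.closedBall 0 1))
    (hQL : LipschitzOnWith L Q (Metric.closedBall 0 1))
    (hQ : ∀ z ∈ Metric.closedBall 0 1, Q z ∈ hopfFibre (S z)) :
    ∫ z in Metric.ball (0 : ℂ) 1, pullbackArea S z =
      -2 * ∫ t in 0..(2 * Real.pi), hopfConnection (fun t ↦ Q (Complex.exp (t * Complex.I))) t := by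
  obtain ⟨M, hM⟩ := lipschitzWith_clampedPolar
  have hG : LipschitzWith (L * M) fun x ↦ Q (clampedPolar x) := by
    rw [← lipschitzOnWith_univ]
    exact hQL.comp hM.lipschitzOnWith fun x _ ↦ clampedPolar_mem x
  have strip : ∀ F : ℍ[ℝ] →L[ℝ] ℝ,
      IsPolarStrip (-Real.pi) Real.pi fun x ↦ F (Q (clampedPolar x)) := fun F ↦
    isPolarStrip_comp_clampedPolar (g := fun z ↦ F (Q z))
      ⟨_, F.lipschitz.comp_lipschitzOnWith hQL⟩
      ⟨‖F‖, fun z hz ↦ by simpa [(hQ z hz).1] using F.le_opNorm (Q z)⟩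
  rw [setIntegral_ball_eq_polar]
  set J : (ℍ[ℝ] →L[ℝ] ℝ) → (ℍ[ℝ] →L[ℝ] ℝ) → ℝ × ℝ → ℝ := fun F F' x ↦
    lineDeriv ℝ (fun x ↦ F (Q (clampedPolar x))) x (1, 0) *
      lineDeriv ℝ (fun x ↦ F' (Q (clampedPolar x))) x (0, 1) -
    lineDeriv ℝ (fun x ↦ F (Q (clampedPolar x))) x (0, 1) *
      lineDeriv ℝ (fun x ↦ F' (Q (clampedPolar x))) x (1, 0) with hJ
  -- The i-component of X̄Y is the sum of the area forms of the coordinate planes (re, i) and (k,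
  -- j), so the integrand is built from two Jacobians.
  have step : ∫ x in Ioo (0 : ℝ) 1 ×ˢ Ioo (-Real.pi) Real.pi,
        x.1 * pullbackArea S (clampedPolar x) =
      ∫ x in Ioo (0 : ℝ) 1 ×ˢ Ioo (-Real.pi) Real.pi, -4 * (J reL imIL x - J imJL imKL x) := by
    refine integral_congr_ae ?_
    filter_upwards [ae_differentiableAt_clampedPolar hS,
      ae_restrict_of_ae (hG.ae_differentiableAt (μ := volume)),
      ae_restrict_mem (measurableSet_Ioo.prod measurableSet_Ioo)] with x hxS hxQ hx
    obtain ⟨r, t⟩ := x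
    have dQ := hxQ.hasFDerivAt
    have d : ∀ (F : ℍ[ℝ] →L[ℝ] ℝ) v, lineDeriv ℝ (fun x ↦ F (Q (clampedPolar x))) (r, t) v =
        F (fderiv ℝ (fun x ↦ Q (clampedPolar x)) (r, t) v) := fun F v ↦
      ((F.hasFDerivAt.comp (r, t) dQ).hasLineDerivAt v).lineDeriv
    rw [mul_pullbackArea_clampedPolar hQ hx.1 hxS dQ]
    simp only [hJ, d]
    simp only [reL_apply, imIL_apply, imJL_apply, imKL_apply, Quaternion.imI_mul,
      Quaternion.re_star, Quaternion.imI_star, Quaternion.imJ_star, Quaternion.imK_star]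
    ring
  have hπ : -Real.pi ≤ Real.pi := by linarith [Real.pi_pos]
  rw [step, integral_const_mul, integral_sub ((strip _).integrableOn_jacobian (strip _))
    ((strip _).integrableOn_jacobian (strip _)), (strip _).integral_jacobian (strip _) hπ,
    (strip _).integral_jacobian (strip _) hπ]
  have hγ : ∀ t : ℝ, clampedPolar (1, t) = Complex.exp (t * Complex.I) := fun t ↦ by
    simpa using clampedPolar_of_mem (r := 1) (by simp) t
  simp only [lineDeriv_snd_eq_deriv, hγ]
  set γ : ℝ → ℍ[ℝ] := fun t ↦ Q (Complex.exp (t * Complex.I)) with hγdef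
  have lγ : LipschitzWith (L * M) γ := by
    have := hG.comp (LipschitzWith.prodMk_left (1 : ℝ))
    simpa [Function.comp_def, hγ] using! this
  have pγ : Function.Periodic γ (2 * Real.pi) := fun t ↦ by
    simp only [hγdef]
    rw [Complex.ofReal_add, add_mul, Complex.exp_add]
    simp
  have pω : Function.Periodic (hopfConnection γ) (2 * Real.pi) := fun t ↦ by
    have d : ∀ F : ℍ[ℝ] →L[ℝ] ℝ, deriv (fun s ↦ F (γ s)) (t + 2 * Real.pi) =
        deriv (fun s ↦ F (γ s)) t := fun F ↦ by
      rw [← deriv_comp_add_const]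
      simp only [pγ _]
    simp only [hopfConnection, d, pγ t]
  have shift : ∫ t in 0..(2 * Real.pi), hopfConnection γ t =
      ∫ t in (-Real.pi)..Real.pi, hopfConnection γ t := by
    have := pω.intervalIntegral_add_eq 0 (-Real.pi)
    rwa [zero_add, show -Real.pi + 2 * Real.pi = Real.pi by ring] at this
  have ac : ∀ F : ℍ[ℝ] →L[ℝ] ℝ,
      AbsolutelyContinuousOnInterval (fun s ↦ F (γ s)) (-Real.pi) Real.pi :=
    fun F ↦ (F.lipschitz.comp lγ).lipschitzOnWith.absolutelyContinuousOnInterval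
  have i : ∀ F F' : ℍ[ℝ] →L[ℝ] ℝ, IntervalIntegrable
      (fun t ↦ F (γ t) * deriv (fun s ↦ F' (γ s)) t) volume (-Real.pi) Real.pi :=
    fun F F' ↦ (ac F').intervalIntegrable_deriv.continuousOn_mul (ac F).continuousOn
  -- As γ is closed, the two terms of each antisymmetric pair in ω have equal integrals. Green's
  -- formula produces one term of each pair, which turns the factor -4 into -2.
  have parts : ∀ F F' : ℍ[ℝ] →L[ℝ] ℝ,
      ∫ t in (-Real.pi)..Real.pi, F (γ t) * deriv (fun s ↦ F' (γ s)) t =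
        -∫ t in (-Real.pi)..Real.pi, F' (γ t) * deriv (fun s ↦ F (γ s)) t := fun F F' ↦ by
    have e : γ Real.pi = γ (-Real.pi) := by
      rw [← pγ (-Real.pi)]; ring_nf
    rw [(ac F).integral_mul_deriv_eq_deriv_mul (ac F'), e, sub_self, zero_sub]
    simp only [mul_comm]
  have sum : ∫ t in (-Real.pi)..Real.pi, hopfConnection γ t =
      ((∫ t in (-Real.pi)..Real.pi, reL (γ t) * deriv (fun s ↦ imIL (γ s)) t) -
        (∫ t in (-Real.pi)..Real.pi, imIL (γ t) * deriv (fun s ↦ reL (γ s)) t) -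
        ∫ t in (-Real.pi)..Real.pi, imJL (γ t) * deriv (fun s ↦ imKL (γ s)) t) +
        ∫ t in (-Real.pi)..Real.pi, imKL (γ t) * deriv (fun s ↦ imJL (γ s)) t := by
    rw [← intervalIntegral.integral_sub (i _ _) (i _ _),
      ← intervalIntegral.integral_sub ((i _ _).sub (i _ _)) (i _ _),
      ← intervalIntegral.integral_add (((i _ _).sub (i _ _)).sub (i _ _)) (i _ _)]
    rfl
  rw [shift, sum, parts imIL reL, parts imKL imJL]
  ring

/-- The pullback of the area form under a Lipschitz map from the disk to `S²` is integrable. -/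
theorem integrableOn_pullbackArea {S : ℂ → E3} {K : NNReal}
    (hS : LipschitzOnWith K S (Metric.closedBall 0 1))
    (hm : MapsTo S (Metric.closedBall 0 1) S2) :
    IntegrableOn (pullbackArea S) (Metric.ball 0 1) := by
  have hc : Continuous fun y : E3 × E3 × E3 ↦ areaForm y.1 y.2.1 y.2.2 := by
    simp only [areaForm]
    exact continuous_fst.inner (contDiff_cross.continuous.comp continuous_snd)
  have md : ∀ v : ℂ, StronglyMeasurable fun z ↦ fderiv ℝ S z v := fun v ↦
    (measurable_fderiv_apply_const ℝ S v).stronglyMeasurable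
  have mS : AEStronglyMeasurable S (volume.restrict (Metric.ball (0 : ℂ) 1)) :=
    (hS.continuousOn.mono Metric.ball_subset_closedBall).aestronglyMeasurable
      Metric.isOpen_ball.measurableSet
  have mP : AEStronglyMeasurable (pullbackArea S) (volume.restrict (Metric.ball (0 : ℂ) 1)) := by
    have h := mS.prodMk ((md 1).aestronglyMeasurable.prodMk (md Complex.I).aestronglyMeasurable
      (μ := volume.restrict (Metric.ball (0 : ℂ) 1)))
    exact (hc.comp_aestronglyMeasurable h).congr (.of_forall fun z ↦ rfl)
  have hK : IsCompact (S2 ×ˢ Metric.closedBall (0 : E3) K ×ˢ Metric.closedBall (0 : E3) K) :=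
    (isCompact_sphere (0 : E3) 1).prod ((isCompact_closedBall _ _).prod (isCompact_closedBall _ _))
  obtain ⟨B, hB⟩ := hK.exists_bound_of_continuousOn hc.continuousOn
  refine IntegrableOn.of_bound measure_ball_lt_top mP B ?_
  · filter_upwards [ae_restrict_mem Metric.isOpen_ball.measurableSet] with z hz
    have hn : ‖fderiv ℝ S z‖ ≤ K := norm_fderiv_le_of_lipschitzOn ℝ
      (mem_of_superset (Metric.isOpen_ball.mem_nhds hz) Metric.ball_subset_closedBall) hS
    have hv : ∀ v : ℂ, ‖v‖ = 1 → fderiv ℝ S z v ∈ Metric.closedBall (0 : E3) K := fun v hv ↦ by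
      rw [mem_closedBall_zero_iff]
      exact ((fderiv ℝ S z).le_opNorm v).trans (by rwa [hv, mul_one])
    have hz2 : S z ∈ S2 := hm (Metric.ball_subset_closedBall hz)
    exact hB (S z, fderiv ℝ S z 1, fderiv ℝ S z Complex.I)
      (mk_mem_prod hz2 (mk_mem_prod (hv 1 norm_one) (hv Complex.I Complex.norm_I)))

/-! ### Great-circle arcs and their horizontal lifts. -/

section GreatArc

variable {p p' : E3} {s : ℝ}

/-- The chord between non-antipodal points of the sphere does not meet the ray opposite to the
first one. -/
theorem chord_add_smul_ne_zero (hp : p ∈ S2) (hp' : p' ∈ S2) (h : p' ≠ -p)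
    (hs : s ∈ Icc (0 : ℝ) 1) {c : ℝ} (hc : 0 ≤ c) : (1 - s) • p + s • p' + c • p ≠ 0 := by
  intro h0
  rw [mem_sphere_zero_iff_norm] at hp hp'
  have e : s • p' = -((1 - s + c) • p) := by
    rw [eq_neg_iff_add_eq_zero, ← h0]; module
  have hn := congrArg norm e
  rw [norm_neg, norm_smul, norm_smul, hp, hp', Real.norm_of_nonneg hs.1,
    Real.norm_of_nonneg (by linarith [hs.2]), mul_one, mul_one] at hn
  have hs0 : s ≠ 0 := by
    rintro rfl; linarith
  rw [← hn, ← smul_neg] at e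
  exact h (smul_right_injective E3 hs0 e)

theorem chord_ne_zero (hp : p ∈ S2) (hp' : p' ∈ S2) (h : p' ≠ -p) (hs : s ∈ Icc (0 : ℝ) 1) :
    (1 - s) • p + s • p' ≠ 0 := by
  simpa using chord_add_smul_ne_zero hp hp' h hs le_rfl

theorem inv_norm_smul_mem_S2 {v : E3} (hv : v ≠ 0) : ‖v‖⁻¹ • v ∈ S2 := by
  rw [mem_sphere_zero_iff_norm, norm_smul, norm_inv, norm_norm,
    inv_mul_cancel₀ (norm_ne_zero_iff.2 hv)]

theorem greatArc_mem (hp : p ∈ S2) (hp' : p' ∈ S2) (h : p' ≠ -p) (hs : s ∈ Icc (0 : ℝ) 1) :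
    greatArc p p' s ∈ S2 :=
  inv_norm_smul_mem_S2 (chord_ne_zero hp hp' h hs)

theorem greatArc_zero (hp : p ∈ S2) : greatArc p p' 0 = p := by
  rw [mem_sphere_zero_iff_norm] at hp
  simp [greatArc, hp]

theorem greatArc_one (hp' : p' ∈ S2) : greatArc p p' 1 = p' := by
  rw [mem_sphere_zero_iff_norm] at hp'
  simp [greatArc, hp']

theorem greatArc_ne_neg (hp : p ∈ S2) (hp' : p' ∈ S2) (h : p' ≠ -p) (hs : s ∈ Icc (0 : ℝ) 1) :
    greatArc p p' s ≠ -p := by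
  intro e
  refine chord_add_smul_ne_zero hp hp' h hs (norm_nonneg ((1 - s) • p + s • p')) ?_
  have hn := norm_ne_zero_iff.2 (chord_ne_zero hp hp' h hs)
  rw [greatArc, inv_smul_eq_iff₀ hn] at e
  nth_rewrite 1 [e]
  simp

theorem contDiffAt_inv_norm_smul {v : E3} (hv : v ≠ 0) :
    ContDiffAt ℝ 1 (fun v : E3 ↦ ‖v‖⁻¹ • v) v :=
  ((contDiffAt_norm ℝ hv).inv (norm_ne_zero_iff.2 hv)).smul contDiffAt_id

theorem contDiff_chord (p p' : E3) : ContDiff ℝ 1 fun s : ℝ ↦ (1 - s) • p + s • p' := by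
  fun_prop

theorem contDiffAt_greatArc (hp : p ∈ S2) (hp' : p' ∈ S2) (h : p' ≠ -p)
    (hs : s ∈ Icc (0 : ℝ) 1) : ContDiffAt ℝ 1 (greatArc p p') s :=
  ContDiffAt.comp (g := fun v : E3 ↦ ‖v‖⁻¹ • v) (f := fun s : ℝ ↦ (1 - s) • p + s • p') s
    (contDiffAt_inv_norm_smul (chord_ne_zero hp hp' h hs)) (contDiff_chord p p').contDiffAt

/-- Along the arc, p × x only changes by a scalar. The lift therefore has the form (α + βw)q with
the fixed axis w = p × p', as `complexPart_holonomy` requires. -/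
theorem dihedral_greatArc (p p' : E3) (s : ℝ) :
    dihedral p (greatArc p p' s) = (√(2 + 2 * inner ℝ p (greatArc p p' s)) / 2) • (1 : ℍ[ℝ]) +
      ((√(2 + 2 * inner ℝ p (greatArc p p' s)))⁻¹ * (‖(1 - s) • p + s • p'‖⁻¹ * s)) •
        imQuat (cross p p') := by
  have hc : cross p (greatArc p p' s) = (‖(1 - s) • p + s • p'‖⁻¹ * s) • cross p p' := by
    ext i
    fin_cases i <;> simp [greatArc] <;> ring
  rw [dihedral_eq, hc, imQuat_smul, smul_smul, ← Algebra.algebraMap_eq_smul_one,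
    Quaternion.algebraMap_def]

theorem dihedral_self (hp : p ∈ S2) : dihedral p p = 1 := by
  have h2 : √(2 + 2 * 1 : ℝ) = 2 := by
    rw [show (2 + 2 * 1 : ℝ) = 2 ^ 2 by norm_num, Real.sqrt_sq (by norm_num)]
  have hc : cross p p = 0 := by
    ext i; fin_cases i <;> simp <;> ring
  rw [mem_sphere_zero_iff_norm] at hp
  rw [dihedral_eq, hc, real_inner_self_eq_norm_sq, hp, one_pow, h2]
  ext <;> simp

theorem inner_cross_self (p p' : E3) : inner ℝ p (cross p p') = 0 := by
  simp only [inner_E3, cross_zero, cross_one, cross_two]; ring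

/-- The phase of a lift of a great-circle arc, relative to the horizontal lift. -/
theorem complexPart_holonomy_greatArc (hp : p ∈ S2) (hp' : p' ∈ S2) (h : p' ≠ -p) {q : ℍ[ℝ]}
    (hq : q ∈ hopfFibre p) {γ : ℝ → ℍ[ℝ]} {K : NNReal} (hγ : LipschitzWith K γ)
    (h1 : ∀ t, ‖γ t‖ = 1) {u v : ℝ} (huv : u < v)
    (hf : ∀ t ∈ Icc u v, γ t ∈ hopfFibre (greatArc p p' ((t - u) / (v - u)))) :
    complexPart (star (dihedral p p' * q) * γ v) = complexPart (star q * γ u) *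
      Complex.exp ((∫ t in u..v, hopfConnection γ t : ℝ) * Complex.I) := by
  have hd : 0 < v - u := sub_pos.2 huv
  have unit : ∀ t ∈ Icc u v, (t - u) / (v - u) ∈ Icc (0 : ℝ) 1 := fun t ht ↦
    ⟨div_nonneg (by linarith [ht.1]) hd.le, (div_le_one hd).2 (by linarith [ht.2])⟩
  have lip : ∀ {f : ℝ → ℝ}, (∀ s ∈ Icc (0 : ℝ) 1, ContDiffAt ℝ 1 f s) →
      ∃ K, LipschitzOnWith K (fun t ↦ f ((t - u) / (v - u))) (Icc u v) := by
    intro f hf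
    have l : LipschitzOnWith 1 (fun t : ℝ ↦ t) (Icc u v) := LipschitzWith.id.lipschitzOnWith
    refine l.exists_comp_of_contDiffAt (Φ := fun t ↦ f ((t - u) / (v - u))) isCompact_Icc
      fun t ht ↦ ?_
    exact (hf _ (unit t ht)).comp t ((contDiffAt_id.sub contDiffAt_const).div_const _)
  have pos : ∀ s ∈ Icc (0 : ℝ) 1, 0 < 1 + inner ℝ p (greatArc p p' s) := fun s hs ↦
    one_add_inner_pos hp (greatArc_mem hp hp' h hs) (greatArc_ne_neg hp hp' h hs)
  have cs : ∀ s ∈ Icc (0 : ℝ) 1,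
      ContDiffAt ℝ 1 (fun s ↦ √(2 + 2 * inner ℝ p (greatArc p p' s))) s := fun s hs ↦
    (contDiffAt_const.add (contDiffAt_const.mul
      (contDiffAt_const.inner ℝ (contDiffAt_greatArc hp hp' h hs)))).sqrt
        (by linarith [pos s hs])
  have cβ : ∀ s ∈ Icc (0 : ℝ) 1, ContDiffAt ℝ 1 (fun s ↦
      (√(2 + 2 * inner ℝ p (greatArc p p' s)))⁻¹ * (‖(1 - s) • p + s • p'‖⁻¹ * s)) s :=
    fun s hs ↦ ((cs s hs).inv (Real.sqrt_pos.2 (by linarith [pos s hs])).ne').mul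
      ((((contDiff_chord p p').contDiffAt.norm ℝ (chord_ne_zero hp hp' h hs)).inv
        (norm_ne_zero_iff.2 (chord_ne_zero hp hp' h hs))).mul contDiffAt_id)
  have fib : ∀ t ∈ Icc u v, dihedral p (greatArc p p' ((t - u) / (v - u))) * q ∈
      hopfFibre (greatArc p p' ((t - u) / (v - u))) := fun t ht ↦
    dihedral_mul_mem_hopfFibre hp (greatArc_mem hp hp' h (unit t ht)) (pos _ (unit t ht)) hq
  have key := complexPart_holonomy hγ h1 huv.le (lip fun s hs ↦ (cs s hs).div_const 2) (lip cβ) hq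
    (inner_cross_self p p') (H := fun t ↦ dihedral p (greatArc p p' ((t - u) / (v - u))) * q)
    (fun t ↦ by rw [dihedral_greatArc]) (fun t ht ↦ (fib t ht).1)
    (fun t ht ↦ by rw [(fib t ht).2, (hf t ht).2])
  simpa only [sub_self, zero_div, div_self hd.ne', greatArc_zero hp, greatArc_one hp',
    dihedral_self hp, one_mul] using key

end GreatArc

/-! ### Holonomy around the polygon. -/

section Polygon

variable {n : ℕ} {p : ZMod n → S2} {q : ℕ → ℍ[ℝ]}

theorem mem_hopfFibre_of_dihedral (hp : ∀ i : ZMod n, p (i + 1) ≠ -p i)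
    (hq₀ : q 0 ∈ hopfFibre (p 0))
    (hq : ∀ k : ℕ, k < n →
      q (k + 1) = dihedral (p (k : ZMod n)) (p ((k : ZMod n) + 1)) * q k) :
    ∀ k ≤ n, q k ∈ hopfFibre (p (k : ZMod n)) := by
  intro k
  induction k with
  | zero => simpa using hq₀
  | succ k ih =>
    intro hk
    rw [hq k hk, Nat.cast_succ]
    exact dihedral_mul_mem_hopfFibre (p _).2 (p _).2 (one_add_inner_pos (p _).2 (p _).2
      fun e ↦ hp k (Subtype.ext e)) (ih (by omega))

theorem exists_complex_star_mul {x : E3} {q q' : ℍ[ℝ]} (hq : q ∈ hopfFibre x)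
    (hq' : q' ∈ hopfFibre x) : ∃ z : ℂ, ‖z‖ = 1 ∧ star q * q' = (z : ℍ[ℝ]) := by
  obtain ⟨hj, hk⟩ := star_mul_imJ_imK hq.1 hq'.1 (hq.2.trans hq'.2.symm)
  have e : star q * q' = ((complexPart (star q * q') : ℂ) : ℍ[ℝ]) := by
    ext <;> simp [hj, hk]
  refine ⟨complexPart (star q * q'), ?_, e⟩
  have h1 : ‖star q * q'‖ = 1 := by rw [norm_mul, norm_star, hq.1, hq'.1, one_mul]
  have h2 := normSq_eq_one h1
  rw [hj, hk] at h2
  rw [← sq_eq_sq₀ (norm_nonneg _) zero_le_one, ← Complex.normSq_eq_norm_sq, Complex.normSq_apply]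
  simp only [complexPart_re, complexPart_im]
  linarith

theorem complexPart_mul_coe (z : ℂ) (q : ℍ[ℝ]) :
    complexPart ((z : ℍ[ℝ]) * q) = z * complexPart q := by
  apply Complex.ext <;> simp

theorem complexPart_coe (z : ℂ) : complexPart (z : ℍ[ℝ]) = z := by
  apply Complex.ext <;> simp

/-- The phase of a closed lift of the polygon, relative to the horizontal lift. -/
theorem conj_eq_exp_integral (hn : 1 ≤ n) (hp : ∀ i : ZMod n, p (i + 1) ≠ -p i)
    (hq₀ : q 0 ∈ hopfFibre (p 0))
    (hq : ∀ k : ℕ, k < n →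
      q (k + 1) = dihedral (p (k : ZMod n)) (p ((k : ZMod n) + 1)) * q k)
    {γ : ℝ → ℍ[ℝ]} {K : NNReal} (hγ : LipschitzWith K γ) (h1 : ∀ t, ‖γ t‖ = 1)
    (hf : ∀ k : ℕ, k < n → ∀ s ∈ Icc (0 : ℝ) 1, γ (2 * Real.pi * ((k + s) / n)) ∈
      hopfFibre (greatArc (p (k : ZMod n)) (p ((k : ZMod n) + 1)) s))
    (hper : γ (2 * Real.pi) = γ 0) {z : ℂ} (hz : star (q 0) * q n = (z : ℍ[ℝ])) :
    starRingEnd ℂ z =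
      Complex.exp ((∫ t in 0..(2 * Real.pi), hopfConnection γ t : ℝ) * Complex.I) := by
  have hn0 : (0 : ℝ) < n := by exact_mod_cast hn
  have fibq := mem_hopfFibre_of_dihedral hp hq₀ hq
  have chain : ∀ k ≤ n, complexPart (star (q k) * γ (2 * Real.pi * (k / n))) =
      complexPart (star (q 0) * γ 0) *
        Complex.exp ((∫ t in 0..(2 * Real.pi * (k / n)), hopfConnection γ t : ℝ) *
          Complex.I) := by
    intro k
    induction k with
    | zero => simp
    | succ k ih =>
      intro hk
      have hlen : 2 * Real.pi * (((k + 1 : ℕ) : ℝ) / n) - 2 * Real.pi * (k / n) =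
          2 * Real.pi / n := by
        push_cast; field_simp; ring
      have hpos : 0 < 2 * Real.pi / n := by positivity
      have huv : 2 * Real.pi * ((k : ℝ) / n) < 2 * Real.pi * (((k + 1 : ℕ) : ℝ) / n) := by
        linarith
      have e := complexPart_holonomy_greatArc (p (k : ZMod n)).2 (p ((k : ZMod n) + 1)).2
        (fun e ↦ hp k (Subtype.ext e)) (fibq k (by omega)) hγ h1 huv (fun t ht ↦ by
          rw [hlen]
          set s := (t - 2 * Real.pi * (k / n)) / (2 * Real.pi / n) with hs
          have hsI : s ∈ Icc (0 : ℝ) 1 :=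
            ⟨div_nonneg (by linarith [ht.1]) hpos.le, (div_le_one hpos).2 (by linarith [ht.2])⟩
          have ht' : t = 2 * Real.pi * ((k + s) / n) := by
            rw [hs]; field_simp; ring
          rw [ht']
          exact hf k hk s hsI)
      rw [hq k hk, e, ih (by omega), mul_assoc, ← Complex.exp_add, ← add_mul,
        ← Complex.ofReal_add, intervalIntegral.integral_add_adjacent_intervals
          (intervalIntegrable_hopfConnection hγ _ _) (intervalIntegrable_hopfConnection hγ _ _)]
  have e := chain n le_rfl
  rw [div_self hn0.ne', mul_one, hper] at e
  have h0 := hf 0 hn 0 (by simp)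
  simp only [Nat.cast_zero, add_zero, zero_div, mul_zero, zero_add, greatArc_zero (p 0).2] at h0
  obtain ⟨w, hw1, hw⟩ := exists_complex_star_mul hq₀ h0
  -- The phase w of γ(0) relative to q₀ occurs on both sides of `e` and cancels; the conjugate of z
  -- remains because the horizontal lift enters through its conjugate.
  have hn' : star (q n) * γ 0 = ((starRingEnd ℂ z : ℂ) : ℍ[ℝ]) * (w : ℍ[ℝ]) := by
    have hstar : ((starRingEnd ℂ z : ℂ) : ℍ[ℝ]) = star (star (q 0) * q n) := by
      rw [hz]; ext <;> simp
    rw [hstar, ← hw, star_mul, star_star, mul_assoc, ← mul_assoc (q 0),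
      mul_star_self_of_norm_eq_one hq₀.1, one_mul]
  rw [hn', hw, complexPart_mul_coe, complexPart_coe, mul_comm] at e
  exact mul_left_cancel₀ (norm_ne_zero_iff.1 (by rw [hw1]; exact one_ne_zero)) e

/-- For every enclosed region, the area is twice the argument of the holonomy. -/
theorem IsEnclosedRegion.integral_eq (hn : 1 ≤ n) (hp : ∀ i : ZMod n, p (i + 1) ≠ -p i)
    (hq₀ : q 0 ∈ hopfFibre (p 0))
    (hq : ∀ k : ℕ, k < n →
      q (k + 1) = dihedral (p (k : ZMod n)) (p ((k : ZMod n) + 1)) * q k)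
    {S : ℂ → E3} (hS : IsEnclosedRegion p S) :
    ((∫ z in Metric.ball (0 : ℂ) 1, pullbackArea S z : ℝ) : AddCircle (4 * Real.pi)) =
      ((2 * quatArg (star (q 0) * q n) : ℝ) : AddCircle (4 * Real.pi)) := by
  obtain ⟨K, hK⟩ := hS.lipschitz
  obtain ⟨Q, ⟨L, hL⟩, hQ⟩ := exists_lipschitz_hopf_lift hK hS.mapsTo
  have hmem : ∀ t : ℝ, Complex.exp (t * Complex.I) ∈ Metric.closedBall (0 : ℂ) 1 := fun t ↦ by
    rw [mem_closedBall_zero_iff, Complex.norm_exp_ofReal_mul_I]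
  obtain ⟨M, hM⟩ := lipschitzWith_clampedPolar
  have hγ : ∀ t : ℝ, clampedPolar (1, t) = Complex.exp (t * Complex.I) := fun t ↦ by
    simpa using clampedPolar_of_mem (r := 1) (by simp) t
  have lγ : LipschitzWith (L * (M * 1)) fun t : ℝ ↦ Q (Complex.exp (t * Complex.I)) := by
    have h := hL.comp ((hM.comp (LipschitzWith.prodMk_left (1 : ℝ))).lipschitzOnWith (s := univ))
      fun x _ ↦ clampedPolar_mem _
    simpa [Function.comp_def, hγ, lipschitzOnWith_univ] using! h
  have fibq := mem_hopfFibre_of_dihedral hp hq₀ hq n le_rfl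
  rw [ZMod.natCast_self] at fibq
  obtain ⟨z, hz1, hz⟩ := exists_complex_star_mul hq₀ fibq
  have key := conj_eq_exp_integral hn hp hq₀ hq lγ (fun t ↦ (hQ _ (hmem t)).1)
    (fun k hk s hs ↦ by
      have := hQ _ (hmem (2 * Real.pi * ((k + s) / n)))
      rwa [hS.boundary k hk s hs] at this) (by simp) hz
  rw [integral_pullbackArea hK hL hQ]
  set A := ∫ t in 0..(2 * Real.pi), hopfConnection (fun t ↦ Q (Complex.exp (t * Complex.I))) t
  have harg : quatArg (star (q 0) * q n) = Complex.arg z := by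
    rw [hz, quatArg]; simp
  have hexp : Complex.exp (((Complex.arg z : ℝ) : ℂ) * Complex.I) =
      Complex.exp (((-A : ℝ) : ℂ) * Complex.I) := by
    have e1 : Complex.exp (((Complex.arg z : ℝ) : ℂ) * Complex.I) = z := by
      have := Complex.norm_mul_exp_arg_mul_I z
      rwa [hz1, Complex.ofReal_one, one_mul] at this
    rw [e1, ← Complex.conj_conj z, key, ← Complex.exp_conj]
    simp
  -- The argument is determined up to 2πm, and doubling it gives the ambiguity 4πm of the area.
  obtain ⟨m, hm⟩ := Complex.exp_eq_exp_iff_exists_int.1 hexp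
  have hre : Complex.arg z = -A + m * (2 * Real.pi) := by
    have := congrArg Complex.im hm
    simpa using this
  rw [harg, hre, show 2 * (-A + m * (2 * Real.pi)) = -2 * A + m • (4 * Real.pi) by
    rw [zsmul_eq_mul]; ring, AddCircle.coe_add, AddCircle.coe_zsmul, AddCircle.coe_period,
    smul_zero, add_zero]

end Polygon

/-! ### Existence of an enclosed region. -/

/-- Distances on the line add up across the shared endpoints of the intervals, so the constant does
not grow. -/
theorem lipschitzWith_of_lipschitzOnWith_Icc_int {E : Type*} [PseudoMetricSpace E] {f : ℝ → E}
    {K : NNReal} (h : ∀ k : ℤ, LipschitzOnWith K f (Icc (k : ℝ) (k + 1))) : LipschitzWith K f := by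
  have step : ∀ (m : ℕ) (k : ℤ), LipschitzOnWith K f (Icc (k : ℝ) (k + m)) := by
    intro m
    induction m with
    | zero => intro k; simpa using LipschitzOnWith.of_dist_le_mul (by simp)
    | succ m ih =>
      intro k
      have key : ∀ x ∈ Icc (k : ℝ) (k + (m + 1 : ℕ)), ∀ y ∈ Icc (k : ℝ) (k + (m + 1 : ℕ)), x ≤ y →
          dist (f x) (f y) ≤ K * dist x y := by
        intro x hx y hy hxy
        have h1 := ih k
        have h2 := h (k + m)
        push_cast at hx hy h2
        rw [← add_assoc] at hx hy
        rcases le_total y (k + m) with hym | hym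
        · exact h1.dist_le_mul x ⟨hx.1, hxy.trans hym⟩ y ⟨hy.1, hym⟩
        rcases le_total x (k + m) with hxm | hxm
        · have d1 := h1.dist_le_mul x ⟨hx.1, hxm⟩ (k + m) ⟨hx.1.trans hxm, le_rfl⟩
          have d2 := h2.dist_le_mul (k + m) ⟨le_rfl, by linarith⟩ y ⟨hym, hy.2⟩
          calc dist (f x) (f y) ≤ dist (f x) (f (k + m)) + dist (f (k + m)) (f y) :=
              dist_triangle _ _ _
            _ ≤ K * dist x (k + m) + K * dist ((k : ℝ) + m) y := add_le_add d1 d2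
            _ = K * dist x y := by
              rw [dist_comm x, dist_comm _ y, dist_comm x, Real.dist_eq, Real.dist_eq,
                Real.dist_eq, abs_of_nonneg (by linarith), abs_of_nonneg (by linarith),
                abs_of_nonneg (by linarith)]
              ring
        · exact h2.dist_le_mul x ⟨hxm, hx.2⟩ y ⟨hym, hy.2⟩
      refine LipschitzOnWith.of_dist_le_mul fun x hx y hy ↦ ?_
      rcases le_total x y with hxy | hxy
      · exact key x hx y hy hxy
      · rw [dist_comm, dist_comm x]
        exact key y hy x hx hxy
  refine LipschitzWith.of_dist_le_mul fun x y ↦ ?_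
  obtain ⟨M, hM⟩ := exists_nat_ge (max (x - ⌊min x y⌋) (y - ⌊min x y⌋))
  have hf := Int.floor_le (min x y)
  exact (step M ⌊min x y⌋).dist_le_mul x
    ⟨hf.trans (min_le_left _ _), by linarith [(le_max_left _ _).trans hM]⟩ y
    ⟨hf.trans (min_le_right _ _), by linarith [(le_max_right _ _).trans hM]⟩

section Path

variable {n : ℕ} {p : ZMod n → S2}

/-- The closed path running along a spherical polygon, parametrized over `ℝ/nℤ`. -/
noncomputable def polygonPath (p : ZMod n → S2) (t : ℝ) : E3 :=
  greatArc (p (⌊t⌋ : ZMod n)) (p ((⌊t⌋ : ZMod n) + 1)) (Int.fract t)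

theorem polygonPath_intCast_add (p : ZMod n → S2) (k : ℤ) {s : ℝ} (hs : s ∈ Icc (0 : ℝ) 1) :
    polygonPath p (k + s) = greatArc (p (k : ZMod n)) (p ((k : ZMod n) + 1)) s := by
  rcases hs.2.lt_or_eq with h | rfl
  · have hf : ⌊(k : ℝ) + s⌋ = k := by
      rw [Int.floor_intCast_add, Int.floor_eq_zero_iff.2 ⟨hs.1, h⟩, add_zero]
    rw [polygonPath, Int.fract, hf, add_sub_cancel_left]
  -- At s = 1 the floor already selects the next edge; the two edges agree at their common vertex.
  · have hf : ⌊(k : ℝ) + 1⌋ = k + 1 := by simp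
    rw [polygonPath, Int.fract, hf, greatArc_one (p _).2]
    push_cast
    rw [sub_self, greatArc_zero (p _).2]

theorem polygonPath_periodic (p : ZMod n → S2) : Function.Periodic (polygonPath p) n := by
  intro t
  simp [polygonPath]

theorem exists_lipschitzWith_polygonPath (hn : 1 ≤ n) (hp : ∀ i : ZMod n, p (i + 1) ≠ -p i) :
    ∃ K, LipschitzWith K (polygonPath p) := by
  have : NeZero n := ⟨by omega⟩
  have edge : ∀ i : ZMod n, ∃ K, LipschitzOnWith K
      (greatArc (p i) (p (i + 1))) (Icc (0 : ℝ) 1) := fun i ↦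
    (LipschitzWith.id.lipschitzOnWith (s := Icc (0 : ℝ) 1)).exists_comp_of_contDiffAt
      isCompact_Icc fun s hs ↦ contDiffAt_greatArc (p _).2 (p _).2
        (fun e ↦ hp i (Subtype.ext e)) hs
  choose K hK using edge
  refine ⟨Finset.univ.sup K, lipschitzWith_of_lipschitzOnWith_Icc_int fun k ↦
    LipschitzOnWith.of_dist_le_mul fun x hx y hy ↦ ?_⟩
  have e : ∀ x ∈ Icc (k : ℝ) (k + 1), polygonPath p x =
      greatArc (p (k : ZMod n)) (p ((k : ZMod n) + 1)) (x - k) := fun x hx ↦ by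
    rw [← polygonPath_intCast_add p k ⟨by linarith [hx.1], by linarith [hx.2]⟩, add_sub_cancel]
  rw [e x hx, e y hy]
  refine ((hK k).dist_le_mul (x - k) ⟨by linarith [hx.1], by linarith [hx.2]⟩ (y - k)
    ⟨by linarith [hy.1], by linarith [hy.2]⟩).trans ?_
  rw [dist_sub_right]
  gcongr
  exact Finset.le_sup (Finset.mem_univ _)

theorem polygonPath_mem (hp : ∀ i : ZMod n, p (i + 1) ≠ -p i) (t : ℝ) : polygonPath p t ∈ S2 :=
  greatArc_mem (p _).2 (p _).2 (fun e ↦ hp _ (Subtype.ext e))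
    ⟨Int.fract_nonneg t, (Int.fract_lt_one t).le⟩

/-- The path along the polygon as a function on the plane, constant on rays. -/
noncomputable def polygonLoop (p : ZMod n → S2) (z : ℂ) : E3 :=
  polygonPath p (n * (Complex.arg z / (2 * Real.pi)))

/-- A full turn changes the parameter by the period n, so any angle of z may replace the principal
one and the branch cut is harmless. -/
theorem polygonLoop_of_eq (p : ZMod n → S2) {z : ℂ} (hz : ‖z‖ = 1) {x : ℝ}
    (hx : z = Complex.exp (x * Complex.I)) :
    polygonLoop p z = polygonPath p (n * (x / (2 * Real.pi))) := by
  have e1 : Complex.exp (((Complex.arg z : ℝ) : ℂ) * Complex.I) =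
      Complex.exp ((x : ℂ) * Complex.I) := by
    have := Complex.norm_mul_exp_arg_mul_I z
    rw [hz, Complex.ofReal_one, one_mul] at this
    rw [this, hx]
  obtain ⟨m, hm⟩ := Complex.exp_eq_exp_iff_exists_int.1 e1
  have hre : Complex.arg z = x + m * (2 * Real.pi) := by
    have := congrArg Complex.im hm
    simpa using this
  have e : (n : ℝ) * (Complex.arg z / (2 * Real.pi)) = n * (x / (2 * Real.pi)) + m * n := by
    rw [hre]; field_simp
  rw [polygonLoop, e, (polygonPath_periodic p).int_mul m]

theorem exists_lipschitzOnWith_polygonLoop (hn : 1 ≤ n) (hp : ∀ i : ZMod n, p (i + 1) ≠ -p i) :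
    ∃ K, LipschitzOnWith K (polygonLoop p) (Metric.sphere 0 1) := by
  obtain ⟨K, hK⟩ := exists_lipschitzWith_polygonPath hn hp
  refine ⟨K * n, LipschitzOnWith.of_dist_le_mul fun z hz w hw ↦ ?_⟩
  rw [mem_sphere_zero_iff_norm] at hz hw
  have z0 : z ≠ 0 := norm_ne_zero_iff.1 (by rw [hz]; exact one_ne_zero)
  have w0 : w ≠ 0 := norm_ne_zero_iff.1 (by rw [hw]; exact one_ne_zero)
  -- An angle of z chosen close to that of w: they differ by arg(z/w), which is bounded by a
  -- multiple of |z - w|.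
  have ez : z = Complex.exp ((Complex.arg w + Complex.arg (z / w) : ℝ) * Complex.I) := by
    have h1 := Complex.norm_mul_exp_arg_mul_I w
    have h2 := Complex.norm_mul_exp_arg_mul_I (z / w)
    rw [norm_div, hz, hw, div_one, Complex.ofReal_one, one_mul] at h2
    rw [hw, Complex.ofReal_one, one_mul] at h1
    rw [Complex.ofReal_add, add_mul, Complex.exp_add, h1, h2, mul_div_cancel₀ _ w0]
  rw [polygonLoop_of_eq p hz ez, polygonLoop]
  refine (hK.dist_le_mul _ _).trans ?_
  have hang := Complex.angle_le_mul_norm_sub hz hw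
  rw [Complex.angle_eq_abs_arg z0 w0] at hang
  rw [Real.dist_eq, ← mul_sub, ← sub_div, add_sub_cancel_left, abs_mul, abs_div,
    abs_of_pos Real.two_pi_pos, Nat.abs_cast, dist_eq_norm, NNReal.coe_mul, NNReal.coe_natCast,
    mul_assoc]
  gcongr
  rw [div_le_iff₀ Real.two_pi_pos]
  nlinarith [norm_nonneg (z - w), Real.pi_pos]

/-- The cone over the loop is Lipschitz. -/
theorem exists_lipschitzWith_norm_smul_polygonLoop (hn : 1 ≤ n)
    (hp : ∀ i : ZMod n, p (i + 1) ≠ -p i) :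
    ∃ K, LipschitzWith K fun z ↦ ‖z‖ • polygonLoop p z := by
  obtain ⟨K, hK⟩ := exists_lipschitzOnWith_polygonLoop hn hp
  have unit : ∀ z, ‖polygonLoop p z‖ = 1 := fun z ↦
    mem_sphere_zero_iff_norm.1 (polygonPath_mem hp _)
  have proj : ∀ z : ℂ, z ≠ 0 → polygonLoop p z = polygonLoop p (‖z‖⁻¹ • z) := fun z hz ↦ by
    rw [polygonLoop, polygonLoop, Complex.real_smul,
      Complex.arg_real_mul _ (inv_pos.2 (norm_pos_iff.2 hz))]
  have mem : ∀ z : ℂ, z ≠ 0 → ‖z‖⁻¹ • z ∈ Metric.sphere (0 : ℂ) 1 := fun z hz ↦ by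
    rw [mem_sphere_zero_iff_norm, norm_smul, norm_inv, norm_norm,
      inv_mul_cancel₀ (norm_ne_zero_iff.2 hz)]
  refine ⟨1 + K * 2, LipschitzWith.of_dist_le_mul fun z w ↦ ?_⟩
  simp only [dist_eq_norm]
  push_cast
  rcases eq_or_ne z 0 with rfl | hz
  · rw [norm_zero, zero_smul, zero_sub, norm_neg, norm_smul, norm_norm, unit, zero_sub, norm_neg]
    nlinarith [norm_nonneg w, K.coe_nonneg, mul_nonneg K.coe_nonneg (norm_nonneg w)]
  rcases eq_or_ne w 0 with rfl | hw
  · rw [norm_zero, zero_smul, sub_zero, norm_smul, norm_norm, unit, sub_zero]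
    nlinarith [norm_nonneg z, K.coe_nonneg, mul_nonneg K.coe_nonneg (norm_nonneg z)]
  have hnorm : |‖z‖ - ‖w‖| ≤ ‖z - w‖ := abs_norm_sub_norm_le z w
  -- The factor ‖w‖ compensates for the blow-up of radial projection at the origin.
  have dir : ‖w‖ * ‖‖z‖⁻¹ • z - ‖w‖⁻¹ • w‖ ≤ 2 * ‖z - w‖ := by
    have e : ‖w‖ • (‖z‖⁻¹ • z - ‖w‖⁻¹ • w) = (‖w‖ - ‖z‖) • (‖z‖⁻¹ • z) + (z - w) := by
      rw [smul_sub, smul_inv_smul₀ (norm_ne_zero_iff.2 hw), sub_smul,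
        smul_inv_smul₀ (norm_ne_zero_iff.2 hz)]
      abel
    have h1 : ‖(‖w‖ - ‖z‖) • (‖z‖⁻¹ • z)‖ ≤ ‖z - w‖ := by
      rw [norm_smul, mem_sphere_zero_iff_norm.1 (mem z hz), mul_one, Real.norm_eq_abs,
        abs_sub_comm]
      exact hnorm
    rw [← norm_norm w, ← norm_smul, norm_norm, e]
    linarith [norm_add_le ((‖w‖ - ‖z‖) • (‖z‖⁻¹ • z)) (z - w)]
  have e : ‖z‖ • polygonLoop p z - ‖w‖ • polygonLoop p w =
      (‖z‖ - ‖w‖) • polygonLoop p z + ‖w‖ • (polygonLoop p z - polygonLoop p w) := by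
    module
  have h1 : ‖(‖z‖ - ‖w‖) • polygonLoop p z‖ ≤ ‖z - w‖ := by
    rw [norm_smul, unit, mul_one]; exact hnorm
  have h2 : ‖‖w‖ • (polygonLoop p z - polygonLoop p w)‖ ≤ K * 2 * ‖z - w‖ := by
    have d := hK.dist_le_mul _ (mem z hz) _ (mem w hw)
    rw [← proj z hz, ← proj w hw, dist_eq_norm, dist_eq_norm] at d
    rw [norm_smul, norm_norm]
    calc ‖w‖ * ‖polygonLoop p z - polygonLoop p w‖
        ≤ ‖w‖ * (K * ‖‖z‖⁻¹ • z - ‖w‖⁻¹ • w‖) := by gcongr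
      _ = K * (‖w‖ * ‖‖z‖⁻¹ • z - ‖w‖⁻¹ • w‖) := by ring
      _ ≤ K * (2 * ‖z - w‖) := by gcongr
      _ = K * 2 * ‖z - w‖ := by ring
  rw [e]
  linarith [norm_add_le ((‖z‖ - ‖w‖) • polygonLoop p z)
    (‖w‖ • (polygonLoop p z - polygonLoop p w))]

/-- Finitely many subspaces of dimension at most 2 do not cover ℝ³. The vector found is the apex of
the cone below. -/
theorem exists_notMem_span_pair (hn : 1 ≤ n) (p : ZMod n → S2) :
    ∃ m : E3, ∀ i : ZMod n, m ∉ Submodule.span ℝ {(p i : E3), (p (i + 1) : E3)} := by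
  classical
  have : NeZero n := ⟨by omega⟩
  set s : Finset (Submodule ℝ E3) := Finset.univ.image fun i : ZMod n ↦
    Submodule.span ℝ {(p i : E3), (p (i + 1) : E3)} with hs
  have htop : ⊤ ∉ s := by
    intro h
    obtain ⟨i, -, hi⟩ := Finset.mem_image.1 h
    have h1 := finrank_span_le_card (R := ℝ) ({(p i : E3), (p (i + 1) : E3)} : Set E3)
    rw [hi, finrank_top, finrank_euclideanSpace_fin] at h1
    have h2 := Finset.card_le_two (a := (p i : E3)) (b := (p (i + 1) : E3))
    simp only [toFinset_insert, toFinset_singleton] at h1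
    omega
  obtain ⟨m, hm⟩ := (ne_univ_iff_exists_notMem _).1 (Subspace.biUnion_ne_univ_of_top_notMem htop)
  refine ⟨m, fun i hi ↦ hm ?_⟩
  exact mem_biUnion (x := Submodule.span ℝ {(p i : E3), (p (i + 1) : E3)})
    (Finset.mem_image_of_mem _ (Finset.mem_univ i)) hi

/-- The straight cone from m to the loop avoids 0: a zero inside the disk would put m in the span of
an edge, and on the circle the loop has norm 1. Its radial projection to the sphere is therefore
Lipschitz. -/
theorem exists_isEnclosedRegion (hn : 1 ≤ n) (hp : ∀ i : ZMod n, p (i + 1) ≠ -p i) :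
    ∃ S : ℂ → E3, IsEnclosedRegion p S := by
  obtain ⟨m, hm⟩ := exists_notMem_span_pair hn p
  obtain ⟨K, hK⟩ := exists_lipschitzWith_norm_smul_polygonLoop hn hp
  have unit : ∀ z, ‖polygonLoop p z‖ = 1 := fun z ↦
    mem_sphere_zero_iff_norm.1 (polygonPath_mem hp _)
  set V : ℂ → E3 := fun z ↦ (1 - ‖z‖) • m + ‖z‖ • polygonLoop p z with hV
  have hV0 : ∀ z ∈ Metric.closedBall (0 : ℂ) 1, V z ≠ 0 := by
    intro z hz h0
    rw [mem_closedBall_zero_iff] at hz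
    rcases hz.lt_or_eq with hlt | heq
    · set t : ℝ := n * (Complex.arg z / (2 * Real.pi)) with ht
      refine hm (⌊t⌋ : ZMod n) ?_
      have hspan : polygonLoop p z ∈ Submodule.span ℝ
          {(p (⌊t⌋ : ZMod n) : E3), (p ((⌊t⌋ : ZMod n) + 1) : E3)} := by
        rw [polygonLoop, ← ht, polygonPath, greatArc]
        exact Submodule.smul_mem _ _ (Submodule.add_mem _
          (Submodule.smul_mem _ _ (Submodule.subset_span (by simp)))
          (Submodule.smul_mem _ _ (Submodule.subset_span (by simp))))
      have h1 : (1 - ‖z‖) • m = -(‖z‖ • polygonLoop p z) := eq_neg_of_add_eq_zero_left h0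
      rw [← inv_smul_smul₀ (sub_pos.2 hlt).ne' m, h1]
      exact Submodule.smul_mem _ _ (Submodule.neg_mem _ (Submodule.smul_mem _ _ hspan))
    · have h1 := unit z
      simp only [hV, heq, sub_self, zero_smul, one_smul, zero_add] at h0
      rw [h0, norm_zero] at h1
      exact zero_ne_one h1
  refine ⟨fun z ↦ ‖V z‖⁻¹ • V z, ?_, fun z hz ↦ inv_norm_smul_mem_S2 (hV0 z hz), ?_⟩
  · obtain ⟨L, hL⟩ := LipschitzOnWith.exists_prodMk
      (s := Metric.closedBall (0 : ℂ) 1) ⟨1, lipschitzWith_one_norm.lipschitzOnWith⟩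
      ⟨K, hK.lipschitzOnWith⟩
    have lV : ∃ K, LipschitzOnWith K V (Metric.closedBall 0 1) :=
      hL.exists_comp_of_contDiffAt (isCompact_closedBall _ _)
        (Φ := fun x : ℝ × E3 ↦ (1 - x.1) • m + x.2) fun z _ ↦ by fun_prop
    obtain ⟨L', hL'⟩ := lV
    exact hL'.exists_comp_of_contDiffAt (isCompact_closedBall _ _)
      (Φ := fun v : E3 ↦ ‖v‖⁻¹ • v) fun z hz ↦ contDiffAt_inv_norm_smul (hV0 z hz)
  · intro k hk s hs
    have hn0 : (0 : ℝ) < n := by exact_mod_cast hn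
    set z := Complex.exp ((2 * Real.pi * ((k + s) / n) : ℝ) * Complex.I) with hz
    have hz1 : ‖z‖ = 1 := Complex.norm_exp_ofReal_mul_I _
    have hloop : polygonLoop p z = greatArc (p (k : ZMod n)) (p ((k : ZMod n) + 1)) s := by
      rw [polygonLoop_of_eq p hz1 hz,
        show (n : ℝ) * (2 * Real.pi * ((k + s) / n) / (2 * Real.pi)) = ((k : ℤ) : ℝ) + s by
          push_cast; field_simp, polygonPath_intCast_add p k hs]
      simp
    have hVz : V z = polygonLoop p z := by simp [hV, hz1]
    change ‖V z‖⁻¹ • V z = _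
    rw [hVz, unit, inv_one, one_smul, hloop]

end Path

end

theorem mainTheorem6 (n : ℕ) (hn : 1 ≤ n) (p : ZMod n → S2)
    (hp : ∀ i : ZMod n, p (i + 1) ≠ -p i)
    (q : ℕ → ℍ[ℝ]) (hq₀ : q 0 ∈ hopfFibre (p 0))
    (hq : ∀ k : ℕ, k < n →
      q (k + 1) = dihedral (p (k : ZMod n)) (p ((k : ZMod n) + 1)) * q k) :
    (∃ z : ℂ, ‖z‖ = 1 ∧ star (q 0) * q n = (z : ℍ[ℝ])) ∧
      HasSignedArea p ((2 * quatArg (star (q 0) * q n) : ℝ) : AddCircle (4 * Real.pi)) := by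
  have fibq := mem_hopfFibre_of_dihedral hp hq₀ hq n le_rfl
  rw [ZMod.natCast_self] at fibq
  refine ⟨exists_complex_star_mul hq₀ fibq, exists_isEnclosedRegion hn hp, fun S hS ↦ ?_⟩
  obtain ⟨K, hK⟩ := hS.lipschitz
  exact ⟨integrableOn_pullbackArea hK hS.mapsTo, hS.integral_eq hn hp hq₀ hq⟩
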